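/- Let $n\ge 1$, $a,b>0$, $p,q\in[1,\infty]$, $\alpha>2$, and let $\beta$ be defined by $\frac1\alpha+\frac1\beta=1$. Let $\delta>0$ and let $Q$ be a polynomial on $\mathbb{R}^n$ (with complex coefficients) that is not identically zero. Write $|x|$ for the Euclidean norm and $\widehat f(y)=\int_{\mathbb{R}^n} f(x)e^{-i x\cdot y}\,dx$. For a measurable function $f:\mathbb{R}^n\to\mathbb{C}$ consider the conditions (i) $\int_{\mathbb{R}^n} e^{pa|x|^\alpha}|f(x)|^p\,dx<\infty$ (for $p=\infty$: $e^{a|x|^\alpha}f(x)$ is essentially bounded); (ii) $\int_{\mathbb{R}^n} e^{qb|y|^\beta}|\widehat f(y)|^q|Q(y)|^\delta\,dy<\infty$ (for $q=\infty$: $e^{b|y|^\beta}|\widehat f(y)||Q(y)|^\delta$ is essentially bounded). (Condition (i) implies $f\in L^1(\mathbb{R}^n)$, so $\widehat f$ is well defined.) If $(a\alpha)^{1/\alpha}(b\beta)^{1/\beta}>\left(\sin\frac{\pi}{2}(\beta-1)\right)^{1/\beta}$, then every measurable $f$ satisfying (i) and (ii) vanishes almost everywhere. If $(a\alpha)^{1/\alpha}(b\beta)^{1/\beta}=\left(\sin\frac{\pi}{2}(\beta-1)\right)^{1/\beta}$,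 then there are infinitely many measurable functions satisfying (i) and (ii) that are linearly independent over $\mathbb{C}$ modulo equality almost everywhere. -/

import Mathlib

open MeasureTheory
open scoped ENNReal

noncomputable section

/-- The Fourier transform on `ℝⁿ` in the normalization
`f̂ y = ∫ f x * exp (-i x·y) dx` (no factor `2π`). -/
def fourierHat {n : ℕ} (f : EuclideanSpace ℝ (Fin n) → ℂ)
    (y : EuclideanSpace ℝ (Fin n)) : ℂ :=
  ∫ x, f x * Complex.exp (-Complex.I * ((inner ℝ x y : ℝ) : ℂ))

/-- The absolute value `|Q y|` of a polynomial (with complex, in particular possibly real,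
coefficients) at a point `y` of `ℝⁿ`. -/
def polyAbs {n : ℕ} (Q : MvPolynomial (Fin n) ℂ) (y : EuclideanSpace ℝ (Fin n)) : ℝ :=
  ‖MvPolynomial.eval (fun i => ((y i : ℝ) : ℂ)) Q‖

/-- `exp (a |x|^α) * f` lies in `L^p(ℝⁿ)`: for finite `p` this is
`∫ exp (p a |x|^α) |f x|^p dx < ∞`, for `p = ∞` the product is essentially bounded. -/
def SpaceDecay {n : ℕ} (a α : ℝ) (p : ℝ≥0∞) (f : EuclideanSpace ℝ (Fin n) → ℂ) : Prop :=
  MemLp (fun x => ((Real.exp (a * ‖x‖ ^ α) : ℝ) : ℂ) * f x) p volume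

/-- The weighted decay condition on the Fourier transform: for finite `q` it is
`∫ exp (q b |y|^β) |f̂ y|^q |Q y|^δ dy < ∞`, and for `q = ∞` it says that
`exp (b |y|^β) |f̂ y| |Q y|^δ` is essentially bounded. -/
def FourierDecay {n : ℕ} (b β δ : ℝ) (q : ℝ≥0∞) (Q : MvPolynomial (Fin n) ℂ)
    (f : EuclideanSpace ℝ (Fin n) → ℂ) : Prop :=
  (q ≠ ∞ → ∫⁻ y : EuclideanSpace ℝ (Fin n), ENNReal.ofReal
      (Real.exp (q.toReal * b * ‖y‖ ^ β) * ‖fourierHat f y‖ ^ q.toReal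
        * polyAbs Q y ^ δ) < ∞) ∧
  (q = ∞ → ∃ C : ℝ, ∀ᵐ y : EuclideanSpace ℝ (Fin n),
      Real.exp (b * ‖y‖ ^ β) * ‖fourierHat f y‖ * polyAbs Q y ^ δ ≤ C)

end

/-!
For the uniqueness part, `f̂` restricted to a line parallel to an axis extends to an entire function
`Φ` with `|Φ z| ≤ C exp (c |Im z|^β)`, while `|Φ x|` times a power of a polynomial decays like
`exp (-b |x|^β)` on the real axis for almost every such line. In a half-plane bounded by the real
axis one multiplies `Φ` by the exponential of a multiple of `(∓ i z)^β`, whose real part on the real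
axis produces the constant `sin (π/2 (β - 1))`; when `b` exceeds `c sin (π/2 (β - 1))` the
Phragmén–Lindelöf principle forces `Φ = 0`.

For sharpness one superposes complex Gaussians `exp (-ℓ |x|² e^w)` along a contour of Hankel type on
which the weight `exp (ν w)` times a double exponential in `σ w` is integrable. Both the
superposition and its Fourier transform are contour integrals of the same kind, and shifting the
contour through the saddle point yields the two critical rates exactly. Lowering `ν` improves the
polynomial factors in both estimates, and differentiation in `|x|²` shifts `ν` by one, which makes
the functions obtained for `ν = 0, -1, -2, …` linearly independent.
-/

open Filter Topology
open scoped Real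

section

variable {β b c C D : ℝ} {Φ : ℂ → ℂ}

theorem sin_pi_div_two_mul_sub_one_pos (h1 : 1 < β) (h2 : β < 2) :
    0 < Real.sin (π / 2 * (β - 1)) :=
  Real.sin_pos_of_pos_of_lt_pi (mul_pos Real.pi_div_two_pos (sub_pos.2 h1))
    (by nlinarith [Real.pi_pos])

theorem re_mul_I_cpow_ofReal (hβ : β ≠ 0) (y : ℝ) :
    ((y * Complex.I : ℂ) ^ (β : ℂ)).re = -(Real.sin (π / 2 * (β - 1)) * |y| ^ β) := by
  have hcos : Real.cos (π / 2 * β) = -Real.sin (π / 2 * (β - 1)) := by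
    rw [← Real.cos_add_pi_div_two]; ring_nf
  rw [Complex.cpow_ofReal_re]
  rcases lt_trichotomy y 0 with hy | rfl | hy
  · have harg : (y * Complex.I : ℂ).arg = -(π / 2) := by
      simpa using Complex.arg_real_mul (-Complex.I) (neg_pos.2 hy)
    rw [harg, neg_mul, Real.cos_neg, hcos]
    simp [mul_comm]
  · simp [Real.zero_rpow hβ]
  · rw [Complex.arg_real_mul _ hy, Complex.arg_I, hcos]
    simp [mul_comm]

theorem diffContOnCl_cpow_const_rightHalfPlane (hβ : 0 < β) :
    DiffContOnCl ℂ (fun w : ℂ => w ^ (β : ℂ)) {w | 0 < w.re} where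
  differentiableOn w hw :=
    (differentiableAt_id.cpow_const (Or.inl hw)).differentiableWithinAt
  continuousOn w hw := by
    rw [Complex.closure_setOfPred_lt_re] at hw
    exact (Complex.continuousAt_cpow_const_of_re_pos (Or.inl hw) (by simpa)).continuousWithinAt

theorem tendsto_exp_mul_sub_rpow_atTop {K : ℝ} (hK : 0 < K) (h1 : 1 < β) (s : ℝ) :
    Tendsto (fun x : ℝ => Real.exp (s * x - K * x ^ β)) atTop (𝓝 0) := by
  have hexp : Tendsto (fun x : ℝ => x * (s - K * x ^ (β - 1))) atTop atBot := by
    refine tendsto_id.atTop_mul_atBot₀ ?_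
    exact tendsto_atBot_add_const_left atTop s (tendsto_neg_atTop_atBot.comp
      ((tendsto_rpow_atTop (by linarith : 0 < β - 1)).const_mul_atTop hK))
  refine (Real.tendsto_exp_atBot.comp hexp).congr' ?_
  filter_upwards [eventually_ge_atTop 0] with x hx
  rw [Function.comp_apply, mul_sub, mul_left_comm, ← Real.rpow_one_add' hx (by linarith),
    add_sub_cancel, mul_comm x s]

theorem superpolynomialDecay_exp_of_le_exp_neg_rpow {G : ℂ → ℂ} {K : ℝ} (hK : 0 < K) (h1 : 1 < β)
    (hG : ∀ t : ℝ, 0 ≤ t → ‖G t‖ ≤ C * Real.exp (-(K * t ^ β))) :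
    Asymptotics.SuperpolynomialDecay atTop Real.exp fun t : ℝ => ‖G t‖ := fun n => by
  refine squeeze_zero' (Eventually.of_forall fun t => by positivity) ?_
    (mul_zero C ▸ (tendsto_exp_mul_sub_rpow_atTop hK h1 n).const_mul C)
  filter_upwards [eventually_ge_atTop 0] with t ht
  calc Real.exp t ^ n * ‖G t‖ ≤ Real.exp t ^ n * (C * Real.exp (-(K * t ^ β))) := by
        gcongr; exact hG t ht
    _ = C * Real.exp (n * t - K * t ^ β) := by
        rw [← Real.exp_nat_mul, mul_left_comm, ← Real.exp_add, sub_eq_add_neg]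

theorem eqOn_zero_rightHalfPlane_of_le_exp_norm_rpow {F : ℂ → ℂ} {K : ℝ}
    (hF : DiffContOnCl ℂ F {w | 0 < w.re}) (h1 : 1 < β) (h2 : β < 2) (hcK : c < K)
    (hC : ∀ w : ℂ, 0 ≤ w.re → ‖F w‖ ≤ C * Real.exp (c * ‖w‖ ^ β))
    (hD : ∀ y : ℝ, ‖F (y * Complex.I)‖
      ≤ D * Real.exp (-(K * Real.sin (π / 2 * (β - 1)) * |y| ^ β))) :
    Set.EqOn F 0 {w | 0 ≤ w.re} := by
  -- The factor `exp (-K w ^ β)` turns growth into decay on the positive real axis, at the cost of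
  -- `exp (K * sin (π / 2 * (β - 1)) * |y| ^ β)` on the imaginary axis.
  let G : ℂ → ℂ := fun w => F w * Complex.exp (-(K * w ^ (β : ℂ)))
  have hG : ∀ w, ‖G w‖ = ‖F w‖ * Real.exp (-(K * (w ^ (β : ℂ)).re)) := fun w => by
    rw [norm_mul, Complex.norm_exp, Complex.neg_re, Complex.re_ofReal_mul]
  have hGd : DiffContOnCl ℂ G {w | 0 < w.re} :=
    hF.smul (Complex.differentiable_exp.comp_diffContOnCl
      ((diffContOnCl_cpow_const_rightHalfPlane (by linarith)).const_smul (K : ℂ)).neg)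
  have hgrowth : ∀ w : ℂ, 0 < w.re → ‖G w‖ ≤ C * Real.exp ((c + |K|) * ‖w‖ ^ β) := fun w hw => by
    have hre : -(K * (w ^ (β : ℂ)).re) ≤ |K| * ‖w‖ ^ β := by
      rw [← Complex.norm_cpow_real]
      refine (neg_le_abs _).trans ?_
      rw [abs_mul]
      exact mul_le_mul_of_nonneg_left (Complex.abs_re_le_norm _) (abs_nonneg K)
    calc ‖G w‖ ≤ C * Real.exp (c * ‖w‖ ^ β) * Real.exp (|K| * ‖w‖ ^ β) := by
          rw [hG]
          exact mul_le_mul (hC w hw.le) (Real.exp_le_exp.2 hre) (Real.exp_nonneg _)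
            ((norm_nonneg _).trans (hC w hw.le))
      _ = C * Real.exp ((c + |K|) * ‖w‖ ^ β) := by rw [mul_assoc, ← Real.exp_add, add_mul]
  have hdecay : ∀ t : ℝ, 0 ≤ t → ‖G t‖ ≤ C * Real.exp (-((K - c) * t ^ β)) := fun t ht => by
    have h := hC t (by simpa)
    rw [Complex.norm_real, Real.norm_eq_abs, abs_of_nonneg ht] at h
    calc ‖G t‖ ≤ C * Real.exp (c * t ^ β) * Real.exp (-(K * t ^ β)) := by
          rw [hG, ← Complex.ofReal_cpow ht, Complex.ofReal_re]; gcongr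
      _ = C * Real.exp (-((K - c) * t ^ β)) := by rw [mul_assoc, ← Real.exp_add]; ring_nf
  have hbdd : ∀ y : ℝ, ‖G (y * Complex.I)‖ ≤ D := fun y => by
    rw [hG, re_mul_I_cpow_ofReal (by linarith), mul_neg, neg_neg, ← mul_assoc]
    refine (mul_le_mul_of_nonneg_right (hD y) (Real.exp_nonneg _)).trans_eq ?_
    rw [mul_assoc, ← Real.exp_add, neg_add_cancel, Real.exp_zero, mul_one]
  have hG0 : Set.EqOn G 0 {w | 0 ≤ w.re} :=
    PhragmenLindelof.eq_zero_on_right_half_plane_of_superexponential_decay hGd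
      ⟨β, h2, c + |K|, .of_bound C (eventually_inf_principal.2 (Eventually.of_forall fun w hw => by
        simpa using hgrowth w hw))⟩
      (superpolynomialDecay_exp_of_le_exp_neg_rpow (sub_pos.2 hcK) h1 hdecay) ⟨D, hbdd⟩
  exact fun w hw => by simpa [G] using hG0 hw

theorem eq_zero_of_le_exp_abs_im_rpow_of_le_exp_neg (hΦ : Differentiable ℂ Φ)
    (h1 : 1 < β) (h2 : β < 2) (hc : 0 ≤ c) (hbc : c * Real.sin (π / 2 * (β - 1)) < b)
    (hC : ∀ z : ℂ, ‖Φ z‖ ≤ C * Real.exp (c * |z.im| ^ β))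
    (hD : ∀ x : ℝ, ‖Φ x‖ ≤ D * Real.exp (-(b * |x| ^ β))) (x : ℝ) : Φ x = 0 := by
  have hS := sin_pi_div_two_mul_sub_one_pos h1 h2
  have hC0 : 0 ≤ C := nonneg_of_mul_nonneg_left ((norm_nonneg _).trans (hC 0)) (Real.exp_pos _)
  have hzero := eqOn_zero_rightHalfPlane_of_le_exp_norm_rpow (F := fun w => Φ (Complex.I * w))
    (C := C) (D := D) (hΦ.comp (differentiable_id.const_mul Complex.I)).diffContOnCl h1 h2
    (by rwa [lt_div_iff₀ hS]) (fun w _ => (hC _).trans ?_) (fun y => ?_)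
  · simpa [← mul_assoc] using hzero (x := -Complex.I * x) (by simp)
  · gcongr
    simpa using Complex.abs_re_le_norm w
  · have hI : Complex.I * (y * Complex.I) = (-y : ℝ) := by
      rw [mul_left_comm, Complex.I_mul_I]; simp
    simpa [hI, div_mul_cancel₀ b hS.ne'] using hD (-y)

theorem exists_mul_rpow_le_mul_rpow_add {b' : ℝ} (hb' : 0 < b') (hb : b' < b) (hβ : 0 < β) :
    ∃ C : ℝ, ∀ u v : ℝ, 0 ≤ u → 0 ≤ v → u ≤ v + 1 → b' * u ^ β ≤ b * v ^ β + C := by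
  have hb0 : 0 < b := hb'.trans hb
  obtain ⟨ρ, hρ0, hρ1, hρβ⟩ : ∃ ρ, 0 < ρ ∧ ρ < 1 ∧ b * ρ ^ β = b' := by
    refine ⟨(b' / b) ^ β⁻¹, by positivity,
      Real.rpow_lt_one (by positivity) ((div_lt_one hb0).2 hb) (by positivity), ?_⟩
    rw [Real.rpow_inv_rpow (by positivity) hβ.ne', mul_div_cancel₀ b' hb0.ne']
  refine ⟨b' * (1 / (1 - ρ)) ^ β, fun u v hu hv huv => ?_⟩
  have h1ρ : 0 < 1 - ρ := by linarith
  rcases le_or_gt (ρ * u) v with h | h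
  · have hmain : b' * u ^ β ≤ b * v ^ β := by
      rw [← hρβ, mul_assoc, ← Real.mul_rpow hρ0.le hu]
      gcongr
    have hrest : 0 ≤ b' * (1 / (1 - ρ)) ^ β := by positivity
    linarith
  · have hu' : u ≤ 1 / (1 - ρ) := by
      rw [le_div_iff₀ h1ρ]; nlinarith
    have hmain : b' * u ^ β ≤ b' * (1 / (1 - ρ)) ^ β := by gcongr
    have hrest : 0 ≤ b * v ^ β := by positivity
    linarith

theorem exists_norm_intervalIntegral_le_exp_neg_rpow {f : ℝ → ℂ} {b' : ℝ} (hf : Continuous f)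
    (hb' : 0 < b') (hb : b' < b) (hβ : 0 < β)
    (hI : Integrable fun x : ℝ => Real.exp (b * |x| ^ β) * ‖f x‖) :
    ∃ D, ∀ y h : ℝ, 0 ≤ h → h ≤ 1 →
      ‖∫ t in y..(y + h), f t‖ ≤ D * Real.exp (-(b' * |y| ^ β)) := by
  obtain ⟨C, hC⟩ := exists_mul_rpow_le_mul_rpow_add hb' hb hβ
  refine ⟨Real.exp C * ∫ t : ℝ, Real.exp (b * |t| ^ β) * ‖f t‖, fun y h h0 h1 => ?_⟩
  set M := Real.exp C * Real.exp (-(b' * |y| ^ β)) with hM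
  have hpoint : ∀ t ∈ Set.Ioc y (y + h), ‖f t‖ ≤ M * (Real.exp (b * |t| ^ β) * ‖f t‖) := by
    intro t ht
    have hyt : |y| ≤ |t| + 1 := by
      have : |y - t| ≤ 1 := abs_le.2 ⟨by linarith [ht.2], by linarith [ht.1]⟩
      linarith [abs_sub_abs_le_abs_sub y t]
    rw [hM, ← mul_assoc, ← Real.exp_add, ← Real.exp_add]
    refine le_mul_of_one_le_left (norm_nonneg _) (Real.one_le_exp ?_)
    linarith [hC |y| |t| (abs_nonneg _) (abs_nonneg _) hyt]
  rw [intervalIntegral.integral_of_le (by linarith)]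
  calc ‖∫ t in Set.Ioc y (y + h), f t‖
      ≤ ∫ t in Set.Ioc y (y + h), ‖f t‖ := norm_integral_le_integral_norm _
    _ ≤ ∫ t in Set.Ioc y (y + h), M * (Real.exp (b * |t| ^ β) * ‖f t‖) :=
      setIntegral_mono_on (hf.norm.integrableOn_Icc.mono_set Set.Ioc_subset_Icc_self)
        (hI.const_mul M).integrableOn measurableSet_Ioc hpoint
    _ ≤ ∫ t : ℝ, M * (Real.exp (b * |t| ^ β) * ‖f t‖) :=
      setIntegral_le_integral (hI.const_mul M) (Eventually.of_forall fun t => by positivity)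
    _ = _ := by rw [integral_const_mul, hM]; ring

theorem eq_zero_of_le_exp_abs_im_rpow_of_integrable (hΦ : Differentiable ℂ Φ)
    (h1 : 1 < β) (h2 : β < 2) (hc : 0 ≤ c) (hbc : c * Real.sin (π / 2 * (β - 1)) < b)
    (hC : ∀ z : ℂ, ‖Φ z‖ ≤ C * Real.exp (c * |z.im| ^ β))
    (hI : Integrable fun x : ℝ => Real.exp (b * |x| ^ β) * ‖Φ x‖) (x : ℝ) : Φ x = 0 := by
  have hcS : 0 ≤ c * Real.sin (π / 2 * (β - 1)) :=
    mul_nonneg hc (sin_pi_div_two_mul_sub_one_pos h1 h2).le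
  obtain ⟨b', hcb', hb'b⟩ := exists_between hbc
  have hcont : Continuous fun t : ℝ => Φ t := hΦ.continuous.comp Complex.continuous_ofReal
  obtain ⟨D, hD⟩ := exists_norm_intervalIntegral_le_exp_neg_rpow hcont (hcS.trans_lt hcb') hb'b
    (by linarith) hI
  obtain ⟨Ψ, hΨ⟩ := hΦ.isExactOn_univ
  replace hΨ : ∀ z, HasDerivAt Ψ (Φ z) z := fun z => hΨ z trivial
  have hFTC : ∀ (z : ℂ) (h : ℝ), ∫ t in (0 : ℝ)..h, Φ (z + t) = Ψ (z + h) - Ψ z := fun z h => by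
    simpa using intervalIntegral.integral_eq_sub_of_hasDerivAt
      (fun t _ => ((hΨ (z + t)).comp_const_add z t).comp_ofReal)
      (Continuous.intervalIntegrable (hΦ.continuous.comp (by fun_prop)) 0 h)
  have hstep : ∀ h : ℝ, 0 ≤ h → h ≤ 1 → ∀ y : ℝ, Ψ (y + h) - Ψ y = 0 := by
    intro h h0 h1'
    refine eq_zero_of_le_exp_abs_im_rpow_of_le_exp_neg (Φ := fun z => Ψ (z + h) - Ψ z) (C := C)
      (D := D)
      (fun z => ?_) h1 h2 hc hcb' (fun z => ?_) (fun y => ?_)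
    · exact ((hΨ (z + h)).comp_add_const z _ |>.sub (hΨ z)).differentiableAt
    · rw [← hFTC]
      refine (intervalIntegral.norm_integral_le_of_norm_le_const
        fun t _ => by simpa using hC (z + t)).trans ?_
      rw [sub_zero, abs_of_nonneg h0]
      exact mul_le_of_le_one_right ((norm_nonneg _).trans (hC z)) h1'
    · have hshift := intervalIntegral.integral_comp_add_left (fun t : ℝ => Φ t) (a := 0) (b := h) y
      simp only [Complex.ofReal_add, add_zero] at hshift
      rw [← hFTC, hshift]
      exact hD y h h0 h1'
  have hconst : (fun t : ℝ => Ψ t) =ᶠ[𝓝[≥] x] fun _ => Ψ x := by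
    filter_upwards [Icc_mem_nhdsGE (show x < x + 1 by linarith)] with t ht
    simpa [sub_eq_zero] using hstep (t - x) (by linarith [ht.1]) (by linarith [ht.2]) x
  exact ((uniqueDiffOn_Ici x x Set.self_mem_Ici).eq_deriv _ (hΨ x).comp_ofReal.hasDerivWithinAt
    ((hasDerivWithinAt_const x _ (Ψ x)).congr_of_eventuallyEq hconst rfl) :)

end

section

variable {m : ℕ}

theorem measurePreserving_fin_cons :
    MeasurePreserving (fun p : (Fin m → ℝ) × ℝ => (Fin.cons p.2 p.1 : Fin (m + 1) → ℝ)) := by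
  convert! (volume_preserving_piFinSuccAbove (fun _ : Fin (m + 1) => ℝ) 0).symm.comp
    Measure.measurePreserving_swap using 1
  funext p
  exact (Fin.insertNth_zero (α := fun _ => ℝ) p.2 p.1).symm

/-- The restriction of `Q` to a line parallel to the first coordinate axis: the one-variable
polynomial `t ↦ Q (t, y)`. -/
noncomputable def linePolynomial (Q : MvPolynomial (Fin (m + 1)) ℂ) (y : Fin m → ℝ) :
    Polynomial ℂ :=
  (MvPolynomial.finSuccEquiv ℂ m Q).map (MvPolynomial.eval fun i => (y i : ℂ))

theorem eval_linePolynomial (Q : MvPolynomial (Fin (m + 1)) ℂ) (y : Fin m → ℝ) (t : ℝ) :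
    (linePolynomial Q y).eval (t : ℂ) =
      MvPolynomial.eval (fun i => (((Fin.cons t y : Fin (m + 1) → ℝ) i : ℝ) : ℂ)) Q := by
  rw [linePolynomial, ← MvPolynomial.eval_eq_eval_mv_eval']
  congr 2
  ext i
  refine Fin.cases ?_ (fun j => ?_) i <;> simp

theorem linePolynomial_ne_zero {Q : MvPolynomial (Fin (m + 1)) ℂ} {y : Fin m → ℝ}
    (h : MvPolynomial.eval (fun i => (y i : ℂ))
      (MvPolynomial.finSuccEquiv ℂ m Q).leadingCoeff ≠ 0) :
    linePolynomial Q y ≠ 0 := fun h0 => h <| by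
  rw [Polynomial.leadingCoeff, ← Polynomial.coeff_map]
  exact (congrArg (Polynomial.coeff · _) h0).trans (Polynomial.coeff_zero _)

theorem continuous_mvPolynomial_eval_ofReal (Q : MvPolynomial (Fin m) ℂ) :
    Continuous fun y : Fin m → ℝ => MvPolynomial.eval (fun i => (y i : ℂ)) Q :=
  (MvPolynomial.continuous_eval Q).comp (by fun_prop)

theorem ae_mvPolynomial_eval_ofReal_ne_zero {Q : MvPolynomial (Fin m) ℂ} (hQ : Q ≠ 0) :
    ∀ᵐ y : Fin m → ℝ, MvPolynomial.eval (fun i => (y i : ℂ)) Q ≠ 0 := by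
  induction m with
  | zero =>
    obtain ⟨c, rfl⟩ := MvPolynomial.C_surjective (Fin 0) Q
    exact Eventually.of_forall fun y => by simpa using hQ
  | succ m ih =>
    have hmeas : MeasurableSet {y : Fin (m + 1) → ℝ |
        MvPolynomial.eval (fun i => (y i : ℂ)) Q ≠ 0} :=
      (isOpen_ne.preimage (continuous_mvPolynomial_eval_ofReal Q)).measurableSet
    have hmp := measurePreserving_fin_cons (m := m)
    rw [← hmp.map_eq, ae_map_iff hmp.measurable.aemeasurable hmeas, Measure.volume_eq_prod,
      Measure.ae_prod_iff_ae_ae (by exact hmp.measurable hmeas)]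
    have hlead : (MvPolynomial.finSuccEquiv ℂ m Q).leadingCoeff ≠ 0 := by simpa using hQ
    filter_upwards [ih hlead] with y hy
    have hroots : {t : ℝ | (linePolynomial Q y).IsRoot (t : ℂ)}.Finite :=
      (Polynomial.finite_setOfPred_isRoot (linePolynomial_ne_zero hy)).preimage
        Complex.ofReal_injective.injOn
    filter_upwards [measure_eq_zero_iff_ae_notMem.1 (hroots.measure_zero volume)] with t ht
    rwa [← eval_linePolynomial]

theorem ae_linePolynomial_ne_zero {Q : MvPolynomial (Fin (m + 1)) ℂ} (hQ : Q ≠ 0) :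
    ∀ᵐ y : Fin m → ℝ, linePolynomial Q y ≠ 0 :=
  (ae_mvPolynomial_eval_ofReal_ne_zero (by simpa using hQ)).mono fun _ => linePolynomial_ne_zero

theorem exists_eventually_le_norm_polynomial_eval_ofReal {P : Polynomial ℂ} (hP : P ≠ 0) :
    ∃ c > 0, ∀ᶠ t : ℝ in cocompact ℝ, c ≤ ‖P.eval (t : ℂ)‖ := by
  rcases lt_or_ge 0 P.degree with h | h
  · refine ⟨1, one_pos, (P.tendsto_norm_atTop h ?_).eventually_ge_atTop 1⟩
    simpa only [Complex.norm_real] using tendsto_norm_cocompact_atTop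
  · rw [Polynomial.eq_C_of_degree_le_zero h] at hP ⊢
    exact ⟨‖P.coeff 0‖, by simpa using hP, by simp⟩

end

theorem ae_eq_zero_of_fourierHat_eq_zero {n : ℕ} {f : EuclideanSpace ℝ (Fin n) → ℂ}
    (hf : Integrable f) (h : ∀ y, fourierHat f y = 0) : f =ᵐ[volume] 0 := by
  have hF : ∀ y, FourierTransform.fourier f y = 0 := fun y => by
    rw [Real.fourier_eq', ← h ((2 * π) • y), fourierHat]
    congr 1 with x
    rw [inner_smul_right, smul_eq_mul, mul_comm]
    push_cast
    ring_nf
  refine ae_eq_zero_of_integral_contDiff_smul_eq_zero hf.locallyIntegrable fun g hg hgc => ?_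
  -- `g` is the Fourier transform of a Schwartz function `ψ`, and `∫ 𝓕ψ f = ∫ ψ 𝓕f`.
  have hg₁ : HasCompactSupport (Complex.ofRealCLM ∘ g) := hgc.comp_left rfl
  have hg₂ : ContDiff ℝ (↑(⊤ : ℕ∞)) (Complex.ofRealCLM ∘ g) := by fun_prop
  let φ : SchwartzMap (EuclideanSpace ℝ (Fin n)) ℂ := hg₁.toSchwartzMap hg₂
  let ψ := FourierTransformInv.fourierInv φ
  have hψφ : FourierTransform.fourier ψ = φ := by simp [ψ]
  have hflip := VectorFourier.integral_fourierIntegral_smul_eq_flip (e := Real.fourierChar)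
    (L := innerₗ (EuclideanSpace ℝ (Fin n))) (μ := volume) (ν := volume)
    (f := (ψ : EuclideanSpace ℝ (Fin n) → ℂ)) (g := f) Real.continuous_fourierChar
    continuous_inner ψ.integrable hf
  rw [flip_innerₗ] at hflip
  calc ∫ x, g x • f x = ∫ x, φ x • f x := by simp [φ]
    _ = ∫ x, ψ x • FourierTransform.fourier f x := by
      rw [← hψφ, SchwartzMap.fourier_coe]; exact hflip
    _ = 0 := by simp [hF]

section

variable {E : Type*} [NormedAddCommGroup E] [NormedSpace ℝ E] [FiniteDimensional ℝ E] [Nontrivial E]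
  [MeasurableSpace E] [BorelSpace E] {μ : Measure E} [μ.IsAddHaarMeasure] {κ : ℝ}

theorem integrable_exp_neg_mul_norm_rpow {ε : ℝ} (hε : 0 < ε) (hκ : 0 < κ) :
    Integrable (fun x : E => Real.exp (-ε * ‖x‖ ^ κ)) μ := by
  rw [integrable_fun_norm_addHaar μ (f := fun r : ℝ => Real.exp (-ε * r ^ κ))]
  simpa using integrableOn_rpow_mul_exp_neg_mul_rpow
    (neg_one_lt_zero.trans_le (Nat.cast_nonneg (Module.finrank ℝ E - 1))) hκ hε

theorem memLp_exp_neg_mul_norm_rpow {ε : ℝ} (hε : 0 < ε) (hκ : 0 < κ) (r : ℝ≥0∞) :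
    MemLp (fun x : E => Real.exp (-ε * ‖x‖ ^ κ)) r μ := by
  have hmeas : AEStronglyMeasurable (fun x : E => Real.exp (-ε * ‖x‖ ^ κ)) μ :=
    (integrable_exp_neg_mul_norm_rpow hε hκ).aestronglyMeasurable
  rcases eq_or_ne r 0 with rfl | hr0
  · exact memLp_zero_iff_aestronglyMeasurable.2 hmeas
  rcases eq_or_ne r ∞ with rfl | hr
  · refine memLp_top_of_bound hmeas 1 (Eventually.of_forall fun x => ?_)
    rw [Real.norm_of_nonneg (Real.exp_nonneg _), Real.exp_le_one_iff, neg_mul,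
      Left.neg_nonpos_iff]
    positivity
  · rw [← integrable_norm_rpow_iff hmeas hr0 hr]
    convert integrable_exp_neg_mul_norm_rpow (E := E) (μ := μ)
      (mul_pos hε (ENNReal.toReal_pos hr0 hr)) hκ using 2 with x
    rw [Real.norm_of_nonneg (Real.exp_nonneg _), ← Real.exp_mul]
    ring_nf

theorem integrable_exp_mul_norm_rpow_mul_of_memLp {a a' : ℝ} {g : E → ℝ} {r : ℝ≥0∞} (hr : 1 ≤ r)
    (hg : MemLp (fun x => Real.exp (a * ‖x‖ ^ κ) * g x) r μ) (ha : a' < a) (hκ : 0 < κ) :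
    Integrable (fun x => Real.exp (a' * ‖x‖ ^ κ) * g x) μ := by
  have := ENNReal.HolderConjugate.conjExponent hr
  have h := (memLp_exp_neg_mul_norm_rpow (sub_pos.2 ha) hκ r.conjExponent).integrable_mul
    (p := r.conjExponent) (q := r) hg
  convert h using 2 with x
  rw [Pi.mul_apply, ← mul_assoc, ← Real.exp_add]
  ring_nf

end

section

variable {n : ℕ} {f : EuclideanSpace ℝ (Fin n) → ℂ}

theorem SpaceDecay.integrable [NeZero n] {a a' α : ℝ} {p : ℝ≥0∞} (hf : SpaceDecay a α p f)
    (hp : 1 ≤ p) (ha : a' < a) (hα : 0 < α) :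
    Integrable fun x => Real.exp (a' * ‖x‖ ^ α) * ‖f x‖ :=
  integrable_exp_mul_norm_rpow_mul_of_memLp hp
    (by simpa only [norm_mul, Complex.norm_real, Real.norm_of_nonneg (Real.exp_nonneg _)]
      using MemLp.norm hf) ha hα

theorem continuous_fourierHat (hf : Integrable f) : Continuous (fourierHat f) := by
  refine continuous_of_dominated (bound := fun x => ‖f x‖) (fun y => ?_) (fun y => ?_) hf.norm
    (Eventually.of_forall fun x => by fun_prop)
  · exact hf.aestronglyMeasurable.mul (Continuous.aestronglyMeasurable (by fun_prop))
  · exact Eventually.of_forall fun x => by rw [norm_mul, Complex.norm_exp]; simp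

theorem polyAbs_nonneg (Q : MvPolynomial (Fin n) ℂ) (y : EuclideanSpace ℝ (Fin n)) :
    0 ≤ polyAbs Q y :=
  norm_nonneg _

theorem continuous_polyAbs (Q : MvPolynomial (Fin n) ℂ) : Continuous (polyAbs Q) :=
  ((continuous_mvPolynomial_eval_ofReal Q).comp (PiLp.continuous_ofLp 2 fun _ : Fin n => ℝ)).norm

theorem FourierDecay.exists_memLp {b β δ : ℝ} {q : ℝ≥0∞} {Q : MvPolynomial (Fin n) ℂ}
    (h : FourierDecay b β δ q Q f) (hf : Integrable f) (hq : q ≠ 0) (hβ : 0 ≤ β) (hδ : 0 ≤ δ) :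
    ∃ δ' : ℝ, 0 ≤ δ' ∧ MemLp
      (fun y => Real.exp (b * ‖y‖ ^ β) * (‖fourierHat f y‖ * polyAbs Q y ^ δ')) q volume := by
  have hmeas : ∀ δ' : ℝ, 0 ≤ δ' → AEStronglyMeasurable (fun y =>
      Real.exp (b * ‖y‖ ^ β) * (‖fourierHat f y‖ * polyAbs Q y ^ δ')) volume := fun δ' hδ' => by
    have := continuous_fourierHat hf
    have := continuous_polyAbs Q
    exact Continuous.aestronglyMeasurable (by fun_prop (disch := simp [hβ, hδ']))
  rcases eq_or_ne q ∞ with rfl | hqt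
  · obtain ⟨C, hC⟩ := h.2 rfl
    refine ⟨δ, hδ, memLp_top_of_bound (hmeas δ hδ) C (hC.mono fun y hy => ?_)⟩
    have := polyAbs_nonneg Q y
    rwa [Real.norm_of_nonneg (by positivity), ← mul_assoc]
  · have hδq : 0 ≤ δ / q.toReal := by positivity
    refine ⟨δ / q.toReal, hδq, (integrable_norm_rpow_iff (hmeas _ hδq) hq hqt).1
      ⟨(hmeas _ hδq).norm.aemeasurable.pow_const _ |>.aestronglyMeasurable, ?_⟩⟩
    rw [hasFiniteIntegral_iff_ofReal (Eventually.of_forall fun y => by positivity)]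
    refine lt_of_eq_of_lt (lintegral_congr fun y => congrArg _ ?_) (h.1 hqt)
    have := polyAbs_nonneg Q y
    rw [Real.norm_of_nonneg (by positivity), Real.mul_rpow (by positivity) (by positivity),
      Real.mul_rpow (by positivity) (by positivity), ← Real.rpow_mul this,
      div_mul_cancel₀ _ (ENNReal.toReal_pos hq hqt).ne', ← Real.exp_mul]
    ring_nf

end

section

variable {X : Type*} [MeasurableSpace X] {μ : Measure X} {g : X → ℂ} {φ : X → ℝ}

theorem norm_cexp_neg_I_mul_mul_ofReal (z : ℂ) (t : ℝ) :
    ‖Complex.exp (-Complex.I * z * t)‖ = Real.exp (z.im * t) := by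
  simp [Complex.norm_exp]

theorem norm_deriv_cexp_neg_I_mul_mul_ofReal_le {z z₀ : ℂ} (hz : ‖z - z₀‖ ≤ 1) (t : ℝ) :
    ‖Complex.exp (-Complex.I * z * t) * (-Complex.I * t)‖ ≤
      Real.exp ((z₀.im + 2) * t) + Real.exp ((z₀.im - 2) * t) := by
  have him : |z.im - z₀.im| ≤ 1 := by simpa using (Complex.abs_im_le_norm (z - z₀)).trans hz
  have ht : |t| ≤ Real.exp |t| := by linarith [Real.add_one_le_exp |t|]
  have hexp : z.im * t + |t| ≤ z₀.im * t + 2 * |t| := by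
    nlinarith [le_abs_self ((z.im - z₀.im) * t), abs_mul (z.im - z₀.im) t, abs_nonneg t]
  calc ‖Complex.exp (-Complex.I * z * t) * (-Complex.I * t)‖
      = Real.exp (z.im * t) * |t| := by simp [Complex.norm_exp]
    _ ≤ Real.exp (z₀.im * t + 2 * |t|) := by
        refine le_trans ?_ (Real.exp_le_exp.2 hexp)
        rw [Real.exp_add]
        gcongr
    _ ≤ _ := by
        rcases abs_cases t with ⟨h, -⟩ | ⟨h, -⟩ <;> rw [h]
        · exact le_add_of_le_of_nonneg (by ring_nf; rfl) (Real.exp_nonneg _)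
        · exact le_add_of_nonneg_of_le (Real.exp_nonneg _) (by ring_nf; rfl)

theorem differentiable_integral_mul_cexp (hg : AEStronglyMeasurable g μ)
    (hφ : AEStronglyMeasurable φ μ)
    (h : ∀ s : ℝ, Integrable (fun x => Real.exp (s * φ x) * ‖g x‖) μ) :
    Differentiable ℂ fun z : ℂ => ∫ x, g x * Complex.exp (-Complex.I * z * φ x) ∂μ := fun z₀ => by
  have hφ' : AEMeasurable φ μ := hφ.aemeasurable
  have hmeas (z : ℂ) : AEStronglyMeasurable (fun x => g x * Complex.exp (-Complex.I * z * φ x)) μ :=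
    hg.mul (by fun_prop : AEMeasurable _ μ).aestronglyMeasurable
  refine (hasDerivAt_integral_of_dominated_loc_of_deriv_le
    (F' := fun z x => g x * (Complex.exp (-Complex.I * z * φ x) * (-Complex.I * φ x)))
    (Metric.ball_mem_nhds z₀ one_pos) (Eventually.of_forall hmeas) ?_
    (hg.mul (by fun_prop : AEMeasurable _ μ).aestronglyMeasurable)
    (Eventually.of_forall fun x z hz => ?_) ((h (z₀.im + 2)).add (h (z₀.im - 2)))
    (Eventually.of_forall fun x z _ => ?_)).2.differentiableAt
  · refine (h z₀.im).mono' (hmeas z₀) (Eventually.of_forall fun x => ?_)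
    rw [norm_mul, norm_cexp_neg_I_mul_mul_ofReal, mul_comm]
  · rw [norm_mul, Pi.add_apply, ← add_mul, mul_comm]
    gcongr
    exact norm_deriv_cexp_neg_I_mul_mul_ofReal_le (mem_ball_iff_norm.1 hz).le _
  · simpa using ((((hasDerivAt_id z).const_mul (-Complex.I)).mul_const (φ x : ℂ)).cexp).const_mul
      (g x)

end

section

variable {m : ℕ} {a α β : ℝ}

/-- The point of `ℝᵐ⁺¹` with first coordinate `t` and remaining coordinates `y`; for fixed `y` it
runs through a line parallel to the first axis. -/
def linePoint (y : Fin m → ℝ) (t : ℝ) : EuclideanSpace ℝ (Fin (m + 1)) :=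
  WithLp.toLp 2 (Fin.cons t y)

theorem continuous_linePoint (y : Fin m → ℝ) : Continuous (linePoint y) :=
  (PiLp.continuous_toLp 2 fun _ : Fin (m + 1) => ℝ).comp
    (Continuous.finCons continuous_id continuous_const)

theorem abs_le_norm_linePoint (y : Fin m → ℝ) (t : ℝ) : |t| ≤ ‖linePoint y t‖ := by
  simpa [linePoint] using PiLp.norm_apply_le (linePoint y t) 0

theorem measurePreserving_linePoint :
    MeasurePreserving (fun p : (Fin m → ℝ) × ℝ => linePoint p.1 p.2) :=
  (PiLp.volume_preserving_toLp (Fin (m + 1))).comp measurePreserving_fin_cons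

theorem polyAbs_linePoint (Q : MvPolynomial (Fin (m + 1)) ℂ) (y : Fin m → ℝ) (t : ℝ) :
    polyAbs Q (linePoint y t) = ‖(linePolynomial Q y).eval (t : ℂ)‖ := by
  rw [eval_linePolynomial]; rfl

theorem integrable_comp_linePoint_of_integrable_mul_polyAbs_rpow {b β δ : ℝ} (hb : 0 ≤ b)
    (hβ : 0 ≤ β) (hδ : 0 ≤ δ) {Q : MvPolynomial (Fin (m + 1)) ℂ}
    {F : EuclideanSpace ℝ (Fin (m + 1)) → ℂ} (hF : Continuous F) {y : Fin m → ℝ}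
    (hy : linePolynomial Q y ≠ 0)
    (hI : Integrable fun t : ℝ => Real.exp (b * ‖linePoint y t‖ ^ β) *
      (‖F (linePoint y t)‖ * polyAbs Q (linePoint y t) ^ δ)) :
    Integrable fun t : ℝ => Real.exp (b * |t| ^ β) * ‖F (linePoint y t)‖ := by
  obtain ⟨c, hc, hle⟩ := exists_eventually_le_norm_polynomial_eval_ofReal hy
  have hcont : Continuous fun t : ℝ => Real.exp (b * |t| ^ β) * ‖F (linePoint y t)‖ := by
    have := continuous_linePoint y
    fun_prop (disch := simp [hβ])
  refine hcont.locallyIntegrable.integrable_of_isBigO_cocompact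
    (.of_bound (c ^ δ)⁻¹ (hle.mono fun t ht => ?_)) (hI.integrableAtFilter _)
  rw [← polyAbs_linePoint] at ht
  have hline := abs_le_norm_linePoint y t
  have hQ := polyAbs_nonneg Q (linePoint y t)
  rw [Real.norm_of_nonneg (by positivity), Real.norm_of_nonneg (by positivity),
    ← div_eq_inv_mul, le_div_iff₀ (by positivity), mul_assoc]
  gcongr

/-- The Fourier transform along the complex line through `(0, y)` in the direction of the first
coordinate: the continuation of `t ↦ fourierHat f (linePoint y t)` to complex `t`. -/
noncomputable def lineFourier (f : EuclideanSpace ℝ (Fin (m + 1)) → ℂ) (y : Fin m → ℝ) (z : ℂ) :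
    ℂ :=
  ∫ x, f x * Complex.exp (-Complex.I * (inner ℝ x (linePoint y 0) : ℝ)) *
    Complex.exp (-Complex.I * z * (x 0 : ℝ))

theorem fourierHat_linePoint (f : EuclideanSpace ℝ (Fin (m + 1)) → ℂ) (y : Fin m → ℝ) (t : ℝ) :
    fourierHat f (linePoint y t) = lineFourier f y t := by
  refine integral_congr_ae (Eventually.of_forall fun x => ?_)
  simp only
  rw [mul_assoc, ← Complex.exp_add]
  congr 2
  simp only [linePoint, PiLp.inner_apply, Fin.sum_univ_succ, Fin.cons_zero, Fin.cons_succ]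
  simp
  ring

theorem mul_le_mul_rpow_add_inv_mul_rpow (h : α.HolderConjugate β) (ha : 0 < a) {u v : ℝ}
    (hu : 0 ≤ u) (hv : 0 ≤ v) :
    u * v ≤ a * u ^ α + ((a * α) ^ (β - 1) * β)⁻¹ * v ^ β := by
  have hα : 0 < α := h.pos
  have haα : 0 < a * α := by positivity
  have hyoung := Real.young_inequality_of_nonneg (a := (a * α) ^ α⁻¹ * u)
    (b := ((a * α) ^ α⁻¹)⁻¹ * v) (by positivity) (by positivity) h
  have hpow : ((a * α) ^ α⁻¹) ^ β = (a * α) ^ (β - 1) := by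
    rw [← Real.rpow_mul haα.le, inv_mul_eq_div, h.symm.div_conj_eq_sub_one]
  rw [mul_mul_mul_comm, mul_inv_cancel₀ (by positivity), one_mul, Real.mul_rpow (by positivity) hu,
    Real.rpow_inv_rpow haα.le hα.ne', Real.mul_rpow (by positivity) hv,
    Real.inv_rpow (by positivity), hpow] at hyoung
  convert hyoung using 2 <;> field_simp

theorem exp_mul_coord_le (h : α.HolderConjugate β) (ha : 0 < a) (s : ℝ)
    (x : EuclideanSpace ℝ (Fin (m + 1))) :
    Real.exp (s * x 0) ≤
      Real.exp (a * ‖x‖ ^ α) * Real.exp (((a * α) ^ (β - 1) * β)⁻¹ * |s| ^ β) := by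
  rw [← Real.exp_add, Real.exp_le_exp]
  calc s * x 0 ≤ |x 0| * |s| := by rw [mul_comm, ← abs_mul]; exact le_abs_self _
    _ ≤ ‖x‖ * |s| := by gcongr; simpa using PiLp.norm_apply_le x 0
    _ ≤ _ := mul_le_mul_rpow_add_inv_mul_rpow h ha (norm_nonneg x) (abs_nonneg s)

variable {f : EuclideanSpace ℝ (Fin (m + 1)) → ℂ}

theorem norm_lineFourier_le (h : α.HolderConjugate β) (ha : 0 < a)
    (hf : Integrable fun x => Real.exp (a * ‖x‖ ^ α) * ‖f x‖) (y : Fin m → ℝ) (z : ℂ) :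
    ‖lineFourier f y z‖ ≤ (∫ x, Real.exp (a * ‖x‖ ^ α) * ‖f x‖) *
      Real.exp (((a * α) ^ (β - 1) * β)⁻¹ * |z.im| ^ β) := by
  rw [← integral_mul_const]
  refine norm_integral_le_of_norm_le (hf.mul_const _) (Eventually.of_forall fun x => ?_)
  rw [norm_mul, norm_mul, norm_cexp_neg_I_mul_mul_ofReal, Complex.norm_exp,
    mul_comm ‖f x‖]
  simpa [mul_right_comm, mul_comm ‖f x‖] using
    mul_le_mul_of_nonneg_right (exp_mul_coord_le h ha z.im x) (norm_nonneg (f x))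

theorem differentiable_lineFourier (h : α.HolderConjugate β) (ha : 0 < a)
    (hfm : AEStronglyMeasurable f)
    (hf : Integrable fun x => Real.exp (a * ‖x‖ ^ α) * ‖f x‖) (y : Fin m → ℝ) :
    Differentiable ℂ (lineFourier f y) := by
  have hg : AEStronglyMeasurable
      fun x => f x * Complex.exp (-Complex.I * (inner ℝ x (linePoint y 0) : ℝ)) :=
    hfm.mul (Continuous.aestronglyMeasurable (by fun_prop))
  refine differentiable_integral_mul_cexp hg (Continuous.aestronglyMeasurable (by fun_prop))
    fun s => (hf.mul_const (Real.exp (((a * α) ^ (β - 1) * β)⁻¹ * |s| ^ β))).mono'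
      ((Continuous.aestronglyMeasurable (by fun_prop)).mul hg.norm)
      (Eventually.of_forall fun x => ?_)
  rw [norm_mul, norm_norm, norm_mul, Complex.norm_exp, Real.norm_of_nonneg (Real.exp_nonneg _),
    mul_right_comm]
  simpa using mul_le_mul_of_nonneg_right (exp_mul_coord_le h ha s x) (norm_nonneg (f x))

theorem rpow_inv_mul_rpow_inv_rpow (h : α.HolderConjugate β) {u v : ℝ} (hu : 0 ≤ u) (hv : 0 ≤ v) :
    (u ^ (1 / α) * v ^ (1 / β)) ^ β = u ^ (β - 1) * v := by
  rw [Real.mul_rpow (by positivity) (by positivity), ← Real.rpow_mul hu, ← Real.rpow_mul hv,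
    one_div_mul_cancel h.symm.ne_zero, Real.rpow_one, one_div_mul_eq_div,
    h.symm.div_conj_eq_sub_one]

theorem exists_lt_mul_rpow_mul {b S : ℝ} (h1 : 1 < β) (hS : S < (a * α) ^ (β - 1) * (b * β)) :
    ∃ τ, 0 < τ ∧ τ < 1 ∧ S < (τ * a * α) ^ (β - 1) * (τ * b * β) := by
  have hcont : Continuous fun τ : ℝ => (τ * a * α) ^ (β - 1) * (τ * b * β) := by
    fun_prop (disch := simp [h1.le])
  have hev : ∀ᶠ τ in 𝓝 (1 : ℝ), S < (τ * a * α) ^ (β - 1) * (τ * b * β) :=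
    hcont.continuousAt.eventually_const_lt (by simpa using hS)
  obtain ⟨τ, hτ, hτ0, hτ1⟩ := ((hev.filter_mono nhdsWithin_le_nhds).and
    (Ioo_mem_nhdsLT zero_lt_one)).exists
  exact ⟨τ, hτ0, hτ1, hτ⟩

theorem ae_fourierHat_linePoint_eq_zero {b δ : ℝ} (h : α.HolderConjugate β) (h2 : β < 2)
    (ha : 0 < a) (hb : 0 ≤ b) (hδ : 0 ≤ δ) {Q : MvPolynomial (Fin (m + 1)) ℂ} (hQ : Q ≠ 0)
    (hab : Real.sin (π / 2 * (β - 1)) < (a * α) ^ (β - 1) * (b * β)) (hfm : AEStronglyMeasurable f)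
    (hf : Integrable fun x => Real.exp (a * ‖x‖ ^ α) * ‖f x‖) (hfi : Integrable f)
    (hfQ : Integrable fun y => Real.exp (b * ‖y‖ ^ β) * (‖fourierHat f y‖ * polyAbs Q y ^ δ)) :
    ∀ᵐ y : Fin m → ℝ, ∀ t : ℝ, fourierHat f (linePoint y t) = 0 := by
  have hα : 0 < α := h.pos
  have hβ : 0 < β := h.symm.pos
  have hc : ((a * α) ^ (β - 1) * β)⁻¹ * Real.sin (π / 2 * (β - 1)) < b := by
    rw [inv_mul_lt_iff₀ (by positivity)]
    linarith
  have hline := (measurePreserving_linePoint.integrable_comp_of_integrable hfQ).prod_right_ae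
  filter_upwards [hline, ae_linePolynomial_ne_zero hQ] with y hy hQy t
  have hI := integrable_comp_linePoint_of_integrable_mul_polyAbs_rpow hb hβ.le hδ
    (continuous_fourierHat hfi) hQy hy
  simp only [fourierHat_linePoint] at hI ⊢
  exact eq_zero_of_le_exp_abs_im_rpow_of_integrable (differentiable_lineFourier h ha hfm hf y)
    h.symm.lt h2 (by positivity) hc (norm_lineFourier_le h ha hf y) hI t

theorem ae_eq_zero_of_ae_fourierHat_linePoint_eq_zero (hfi : Integrable f)
    (h : ∀ᵐ y : Fin m → ℝ, ∀ t : ℝ, fourierHat f (linePoint y t) = 0) : f =ᵐ[volume] 0 := by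
  have hFc := continuous_fourierHat hfi
  have hae : ∀ᵐ y, fourierHat f y = 0 := by
    have hm : MeasurableSet {y | fourierHat f y = 0} :=
      (isClosed_singleton.preimage hFc).measurableSet
    have hmp := measurePreserving_linePoint (m := m)
    rw [← hmp.map_eq, ae_map_iff hmp.measurable.aemeasurable hm, Measure.volume_eq_prod,
      Measure.ae_prod_iff_ae_ae (by exact hmp.measurable hm)]
    exact h.mono fun y hy => Eventually.of_forall hy
  exact ae_eq_zero_of_fourierHat_eq_zero hfi
    (congrFun ((hFc.ae_eq_iff_eq volume continuous_const).1 hae))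

theorem ae_eq_zero_of_spaceDecay_of_fourierDecay {b δ : ℝ} (h : α.HolderConjugate β) (h2 : β < 2)
    (ha : 0 < a) (hb : 0 < b) (hδ : 0 ≤ δ) {p q : ℝ≥0∞} (hp : 1 ≤ p) (hq : 1 ≤ q)
    {Q : MvPolynomial (Fin (m + 1)) ℂ} (hQ : Q ≠ 0)
    (hab : Real.sin (π / 2 * (β - 1)) < (a * α) ^ (β - 1) * (b * β)) (hfm : AEStronglyMeasurable f)
    (hf : SpaceDecay a α p f) (hfQ : FourierDecay b β δ q Q f) : f =ᵐ[volume] 0 := by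
  obtain ⟨τ, hτ0, hτ1, hτ⟩ := exists_lt_mul_rpow_mul h.symm.lt hab
  have hfi : Integrable f := (integrable_norm_iff hfm).1
    (by simpa using hf.integrable hp ha h.pos)
  obtain ⟨δ', hδ', hmem⟩ := hfQ.exists_memLp hfi (zero_lt_one.trans_le hq).ne' h.symm.nonneg hδ
  exact ae_eq_zero_of_ae_fourierHat_linePoint_eq_zero hfi <|
    ae_fourierHat_linePoint_eq_zero h h2 (mul_pos hτ0 ha) (mul_pos hτ0 hb).le hδ' hQ hτ hfm
      (hf.integrable hp (mul_lt_of_lt_one_left ha hτ1) h.pos) hfi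
      (integrable_exp_mul_norm_rpow_mul_of_memLp hq hmem (mul_lt_of_lt_one_left hb hτ1) h.symm.pos)

end

/-- The Hankel contour `+∞ - iθ → -iθ → iθ → +∞ + iθ`, parametrized by arc length with
`u = 0` at the origin. -/
noncomputable def hankelContour (θ u : ℝ) : ℂ :=
  ((max (|u| - θ) 0 : ℝ) : ℂ) + ((max (-θ) (min u θ) : ℝ) : ℂ) * Complex.I

/-- The unit tangent of `hankelContour` (one-sided at the two corners). -/
noncomputable def hankelTangent (θ u : ℝ) : ℂ :=
  if u ≤ -θ then -1 else if u ≤ θ then Complex.I else 1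

/-- The contour integral of `f` along the Hankel contour of half-width `θ`. -/
noncomputable def hankelIntegral (θ : ℝ) (f : ℂ → ℂ) : ℂ :=
  ∫ u, hankelTangent θ u * f (hankelContour θ u)

theorem continuous_hankelContour (θ : ℝ) : Continuous (hankelContour θ) := by
  unfold hankelContour; fun_prop

theorem measurable_hankelTangent (θ : ℝ) : Measurable (hankelTangent θ) := by
  unfold hankelTangent
  exact Measurable.ite measurableSet_Iic measurable_const
    (Measurable.ite measurableSet_Iic measurable_const measurable_const)

theorem norm_hankelTangent (θ u : ℝ) : ‖hankelTangent θ u‖ = 1 := by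
  unfold hankelTangent; split_ifs <;> simp

theorem norm_hankelTangent_mul (θ u : ℝ) (z : ℂ) : ‖hankelTangent θ u * z‖ = ‖z‖ := by
  rw [norm_mul, norm_hankelTangent, one_mul]

theorem hankelContour_re_nonneg (θ u : ℝ) : 0 ≤ (hankelContour θ u).re := by
  simp [hankelContour]

theorem integrable_exp_neg_abs : Integrable fun u : ℝ => Real.exp (-|u|) := by
  rw [← integrableOn_univ, ← Set.Iic_union_Ioi (a := (0 : ℝ)), integrableOn_union]
  constructor
  · refine (integrableOn_exp_mul_Iic one_pos 0).congr_fun (fun u hu => ?_) measurableSet_Iic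
    simp [abs_of_nonpos (Set.mem_Iic.1 hu)]
  · refine (integrableOn_exp_mul_Ioi (by norm_num : (-1 : ℝ) < 0) 0).congr_fun (fun u hu => ?_)
      measurableSet_Ioi
    simp [abs_of_pos (Set.mem_Ioi.1 hu)]

theorem integral_Ioi_comp_add_right (f : ℝ → ℂ) (a c : ℝ) :
    ∫ x in Set.Ioi a, f (x + c) = ∫ x in Set.Ioi (a + c), f x := by
  simpa using (measurePreserving_add_right volume c).setIntegral_preimage_emb
    (measurableEmbedding_addRight c) f (Set.Ioi (a + c))

theorem integral_Ioi_sub_integral_Ioi_eq {f : ℂ → ℂ} (hf : Differentiable ℂ f) {a c d : ℝ}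
    (hc : IntegrableOn (fun x : ℝ => f (x + c * Complex.I)) (Set.Ioi a))
    (hd : IntegrableOn (fun x : ℝ => f (x + d * Complex.I)) (Set.Ioi a))
    (hlim : Tendsto (fun R : ℝ => ∫ y in c..d, f (R + y * Complex.I)) atTop (𝓝 0)) :
    (∫ x in Set.Ioi a, f (x + c * Complex.I)) - ∫ x in Set.Ioi a, f (x + d * Complex.I) =
      Complex.I * ∫ y in c..d, f (a + y * Complex.I) := by
  have h := ((intervalIntegral_tendsto_integral_Ioi a hc tendsto_id).sub
    (intervalIntegral_tendsto_integral_Ioi a hd tendsto_id)).add (hlim.const_mul Complex.I)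
  rw [mul_zero, add_zero] at h
  refine tendsto_nhds_unique (h.congr fun R => ?_) tendsto_const_nhds
  have hrect := Complex.integral_boundary_rect_eq_zero_of_differentiableOn f ⟨a, c⟩ ⟨R, d⟩
    hf.differentiableOn
  simp only [smul_eq_mul] at hrect
  simp only [id]
  linear_combination hrect

section

variable {θ : ℝ} {f : ℂ → ℂ}

theorem abs_hankelContour_im_le (hθ : 0 ≤ θ) (u : ℝ) : |(hankelContour θ u).im| ≤ θ := by
  have : (hankelContour θ u).im = max (-θ) (min u θ) := by simp [hankelContour]
  rw [this, abs_le]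
  exact ⟨le_max_left _ _, max_le (by linarith) (min_le_right _ _)⟩

theorem hankelContour_of_le_neg (hθ : 0 ≤ θ) {u : ℝ} (hu : u ≤ -θ) :
    hankelContour θ u = ((-u - θ : ℝ) : ℂ) + ((-θ : ℝ) : ℂ) * Complex.I := by
  rw [hankelContour, abs_of_nonpos (by linarith), max_eq_left (by linarith),
    min_eq_left (by linarith), max_eq_left (by linarith)]

theorem hankelContour_of_abs_le {u : ℝ} (hu : |u| ≤ θ) :
    hankelContour θ u = ((0 : ℝ) : ℂ) + (u : ℂ) * Complex.I := by
  rw [hankelContour, max_eq_right (by linarith), min_eq_left (abs_le.1 hu).2,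
    max_eq_right (abs_le.1 hu).1]

theorem hankelContour_of_le (hθ : 0 ≤ θ) {u : ℝ} (hu : θ ≤ u) :
    hankelContour θ u = ((u - θ : ℝ) : ℂ) + (θ : ℂ) * Complex.I := by
  rw [hankelContour, abs_of_nonneg (by linarith), max_eq_left (by linarith),
    min_eq_right (by linarith), max_eq_right (by linarith)]

theorem exists_hankelContour_eq (hθ : 0 ≤ θ) (u : ℝ) : ∃ x φ : ℝ,
    hankelContour θ u = x + φ * Complex.I ∧ 0 ≤ x ∧ |φ| ≤ θ ∧ |u| ≤ x + θ ∧
      (x = 0 ∨ |φ| = θ) := by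
  rcases le_or_gt |u| θ with h | h
  · exact ⟨0, u, hankelContour_of_abs_le h, le_rfl, h, by simpa using h, Or.inl rfl⟩
  rcases lt_abs.1 h with h' | h'
  · exact ⟨u - θ, θ, hankelContour_of_le hθ h'.le, by linarith, (abs_of_nonneg hθ).le,
      by rw [abs_of_pos (by linarith)]; linarith, Or.inr (abs_of_nonneg hθ)⟩
  · have hneg : |-θ| = θ := by rw [abs_neg, abs_of_nonneg hθ]
    exact ⟨-u - θ, -θ, hankelContour_of_le_neg hθ (by linarith), by linarith, hneg.le,
      by rw [abs_of_neg (by linarith)]; linarith, Or.inr hneg⟩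

theorem integrable_hankelTangent_mul (hi : Integrable fun u => f (hankelContour θ u)) :
    Integrable fun u => hankelTangent θ u * f (hankelContour θ u) :=
  hi.bdd_mul (measurable_hankelTangent θ).aestronglyMeasurable
    (Eventually.of_forall fun u => (norm_hankelTangent θ u).le)

theorem integrableOn_Ioi_ray (hf : Continuous f) (hθ : 0 ≤ θ)
    (hi : Integrable fun u => f (hankelContour θ u)) {φ : ℝ} (hφ : |φ| = θ) (L : ℝ) :
    IntegrableOn (fun x : ℝ => f (x + φ * Complex.I)) (Set.Ioi L) := by
  have h0 : IntegrableOn (fun x : ℝ => f (x + φ * Complex.I)) (Set.Ioi 0) := by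
    rcases (abs_eq hθ).1 hφ with rfl | rfl
    · refine (hi.comp_add_right φ).integrableOn.congr_fun (fun x hx => ?_) measurableSet_Ioi
      simp only
      rw [hankelContour_of_le hθ (by linarith [Set.mem_Ioi.1 hx]), add_sub_cancel_right]
    · refine (hi.comp_neg.comp_add_right θ).integrableOn.congr_fun (fun x hx => ?_)
        measurableSet_Ioi
      simp only
      rw [hankelContour_of_le_neg hθ (by linarith [Set.mem_Ioi.1 hx]), neg_neg,
        add_sub_cancel_right]
  have hcont : Continuous fun x : ℝ => f (x + φ * Complex.I) := hf.comp (by fun_prop)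
  rcases le_total L 0 with h | h
  · rw [← Set.Ioc_union_Ioi_eq_Ioi h]
    exact (hcont.integrableOn_Icc.mono_set Set.Ioc_subset_Icc_self).union h0
  · exact h0.mono_set (Set.Ioi_subset_Ioi h)

theorem setIntegral_hankelContour_Iic (hθ : 0 ≤ θ) :
    ∫ u in Set.Iic (-θ), hankelTangent θ u * f (hankelContour θ u) =
      -∫ x in Set.Ioi (0 : ℝ), f (x + ((-θ : ℝ) : ℂ) * Complex.I) := by
  have h := integral_Ioi_comp_add_right
    (fun u => hankelTangent θ (-u) * f (hankelContour θ (-u))) 0 θ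
  rw [zero_add] at h
  rw [← integral_comp_neg_Ioi, ← h, ← integral_neg]
  refine setIntegral_congr_fun measurableSet_Ioi fun x hx => ?_
  have hx' : (0 : ℝ) < x := hx
  simp only [hankelTangent, if_pos (by linarith : -(x + θ) ≤ -θ),
    hankelContour_of_le_neg hθ (by linarith : -(x + θ) ≤ -θ), neg_one_mul, neg_neg,
    add_sub_cancel_right]

theorem setIntegral_hankelContour_Ioc (hθ : 0 ≤ θ) :
    ∫ u in Set.Ioc (-θ) θ, hankelTangent θ u * f (hankelContour θ u) =
      Complex.I * ∫ y in (-θ)..θ, f (((0 : ℝ) : ℂ) + y * Complex.I) := by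
  rw [intervalIntegral.integral_of_le (by linarith), ← integral_const_mul]
  refine setIntegral_congr_fun measurableSet_Ioc fun u hu => ?_
  simp only [hankelTangent, if_neg (not_le.2 hu.1), if_pos hu.2,
    hankelContour_of_abs_le (abs_le.2 ⟨hu.1.le, hu.2⟩)]

theorem setIntegral_hankelContour_Ioi (hθ : 0 ≤ θ) :
    ∫ u in Set.Ioi θ, hankelTangent θ u * f (hankelContour θ u) =
      ∫ x in Set.Ioi (0 : ℝ), f (x + (θ : ℂ) * Complex.I) := by
  have h := integral_Ioi_comp_add_right
    (fun u => hankelTangent θ u * f (hankelContour θ u)) 0 θ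
  rw [zero_add] at h
  rw [← h]
  refine setIntegral_congr_fun measurableSet_Ioi fun x hx => ?_
  have hx' : (0 : ℝ) < x := hx
  simp only [hankelTangent, if_neg (by linarith : ¬x + θ ≤ -θ), if_neg (by linarith : ¬x + θ ≤ θ),
    hankelContour_of_le hθ (by linarith : θ ≤ x + θ), one_mul, add_sub_cancel_right]

theorem hankelIntegral_eq_sum (hθ : 0 ≤ θ) (hi : Integrable fun u => f (hankelContour θ u)) :
    hankelIntegral θ f = Complex.I * (∫ y in (-θ)..θ, f (((0 : ℝ) : ℂ) + y * Complex.I)) +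
      (∫ x in Set.Ioi (0 : ℝ), f (x + (θ : ℂ) * Complex.I)) -
      ∫ x in Set.Ioi (0 : ℝ), f (x + ((-θ : ℝ) : ℂ) * Complex.I) := by
  have hI := integrable_hankelTangent_mul hi
  rw [hankelIntegral,
    ← intervalIntegral.integral_Iic_add_Ioi (b := -θ) hI.integrableOn hI.integrableOn,
    ← Set.Ioc_union_Ioi_eq_Ioi (by linarith : -θ ≤ θ),
    setIntegral_union (Set.Ioc_disjoint_Ioi le_rfl) measurableSet_Ioi hI.integrableOn
      hI.integrableOn, setIntegral_hankelContour_Iic hθ, setIntegral_hankelContour_Ioc hθ,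
    setIntegral_hankelContour_Ioi hθ]
  ring

theorem hankelIntegral_eq_sum_shifted (hf : Differentiable ℂ f) (hθ : 0 ≤ θ)
    (hi : Integrable fun u => f (hankelContour θ u)) (L : ℝ) :
    hankelIntegral θ f = Complex.I * (∫ y in (-θ)..θ, f ((L : ℂ) + y * Complex.I)) +
      (∫ x in Set.Ioi L, f (x + (θ : ℂ) * Complex.I)) -
      ∫ x in Set.Ioi L, f (x + ((-θ : ℝ) : ℂ) * Complex.I) := by
  have hray : ∀ {φ : ℝ}, |φ| = θ → (∫ x in Set.Ioi (0 : ℝ), f (x + φ * Complex.I)) =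
      (∫ x in (0 : ℝ)..L, f (x + φ * Complex.I)) + ∫ x in Set.Ioi L, f (x + φ * Complex.I) :=
    fun hφ => (intervalIntegral.integral_interval_add_Ioi
      (integrableOn_Ioi_ray hf.continuous hθ hi hφ 0)
      (integrableOn_Ioi_ray hf.continuous hθ hi hφ L)).symm
  rw [hankelIntegral_eq_sum hθ hi, hray (abs_of_nonneg hθ),
    hray (by rw [abs_neg, abs_of_nonneg hθ])]
  have hrect := Complex.integral_boundary_rect_eq_zero_of_differentiableOn f ⟨0, -θ⟩ ⟨L, θ⟩
    hf.differentiableOn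
  simp only [smul_eq_mul] at hrect
  linear_combination -hrect

theorem hankelIntegral_comp_add_ofReal (hf : Differentiable ℂ f) (hθ : 0 ≤ θ)
    (hi : Integrable fun u => f (hankelContour θ u)) (L : ℝ)
    (hL : Integrable fun u => f (hankelContour θ u + L)) :
    hankelIntegral θ (fun w => f (w + L)) = hankelIntegral θ f := by
  have hray (φ : ℝ) : ∫ x in Set.Ioi (0 : ℝ), f (x + φ * Complex.I + L) =
      ∫ x in Set.Ioi L, f (x + φ * Complex.I) := by
    have h := integral_Ioi_comp_add_right (fun x : ℝ => f (x + φ * Complex.I)) 0 L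
    rw [zero_add] at h
    rw [← h]
    congr 1; ext x
    push_cast; ring_nf
  rw [hankelIntegral_eq_sum hθ hL, hray, hray, hankelIntegral_eq_sum_shifted hf hθ hi L]
  simp only [Complex.ofReal_zero, zero_add, add_comm _ (L : ℂ)]

theorem hankelIntegral_eq_integral_sub_integral (hf : Differentiable ℂ f) (hθ : 0 ≤ θ)
    (hi : Integrable fun u => f (hankelContour θ u))
    (hray : ∀ φ : ℝ, |φ| = θ → Integrable fun x : ℝ => f (x + φ * Complex.I))
    (hlim : Tendsto (fun L : ℝ => ∫ y in (-θ)..θ, f ((L : ℂ) + y * Complex.I)) atBot (𝓝 0)) :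
    hankelIntegral θ f = (∫ x : ℝ, f (x + (θ : ℂ) * Complex.I)) -
      ∫ x : ℝ, f (x + ((-θ : ℝ) : ℂ) * Complex.I) := by
  have hcov := aecover_Ioi (μ := (volume : Measure ℝ)) (tendsto_id (x := (atBot : Filter ℝ)))
  have h := ((hlim.const_mul Complex.I).add (hcov.integral_tendsto_of_countably_generated
    (hray θ (abs_of_nonneg hθ)))).sub (hcov.integral_tendsto_of_countably_generated
    (hray (-θ) (by rw [abs_neg, abs_of_nonneg hθ])))
  rw [mul_zero, zero_add] at h
  exact tendsto_nhds_unique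
    (tendsto_const_nhds.congr fun L => hankelIntegral_eq_sum_shifted hf hθ hi L) h

end

/-- The angle `π / (σ + 1)`, at which `cos (σ θ) = -cos θ`: the three exponentials in
`saddleKernel` then decay at the same rate along the rays at height `±θ`. -/
noncomputable def sectorAngle (σ : ℝ) : ℝ := π / (σ + 1)

/-- The integrand `exp (-s e^w - t e^(-w) + e^(σ w) / σ + ν w)`. For `t = 0` and `s = |x|²` it is
a Gaussian in `x` of complex width `e^w`; the Fourier transform exchanges `s` and `t`. -/
noncomputable def saddleKernel (σ s t ν : ℝ) (w : ℂ) : ℂ :=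
  Complex.exp (-(s : ℂ) * Complex.exp w - (t : ℂ) * Complex.exp (-w) +
    Complex.exp ((σ : ℂ) * w) / (σ : ℂ) + (ν : ℂ) * w)

/-- The integral of `saddleKernel` along the Hankel contour of half-width `sectorAngle σ`. -/
noncomputable def saddleIntegral (σ s t ν : ℝ) : ℂ :=
  hankelIntegral (sectorAngle σ) (saddleKernel σ s t ν)

theorem exists_mul_sub_exp_le {σ k : ℝ} (hσ : 0 < σ) (hk : 0 < k) (ν : ℝ) :
    ∃ C : ℝ, ∀ x : ℝ, 0 ≤ x → ν * x - k * Real.exp (σ * x) ≤ C - x := by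
  refine ⟨(ν + 1) ^ 2 / (2 * (k * σ ^ 2)), fun x hx => ?_⟩
  have hexp : k * ((σ * x) ^ 2 / 2) ≤ k * Real.exp (σ * x) := by
    have := Real.quadratic_le_exp_of_nonneg (mul_nonneg hσ.le hx)
    gcongr; nlinarith [mul_nonneg hσ.le hx]
  have hsq : (ν + 1) ^ 2 / (2 * (k * σ ^ 2)) + k * ((σ * x) ^ 2 / 2) - (ν + 1) * x =
      ((ν + 1) - k * σ ^ 2 * x) ^ 2 / (2 * (k * σ ^ 2)) := by
    field_simp; ring
  have hnonneg : 0 ≤ ((ν + 1) - k * σ ^ 2 * x) ^ 2 / (2 * (k * σ ^ 2)) := by positivity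
  linarith

section

variable {σ : ℝ}

theorem sectorAngle_pos (hσ : 1 < σ) : 0 < sectorAngle σ :=
  div_pos Real.pi_pos (by linarith)

theorem sectorAngle_lt (hσ : 1 < σ) : sectorAngle σ < π / 2 :=
  div_lt_div_of_pos_left Real.pi_pos two_pos (by linarith)

theorem cos_sectorAngle_pos (hσ : 1 < σ) : 0 < Real.cos (sectorAngle σ) :=
  Real.cos_pos_of_mem_Ioo ⟨by linarith [sectorAngle_pos hσ, Real.pi_pos], sectorAngle_lt hσ⟩

theorem cos_sectorAngle_le {φ : ℝ} (hσ : 1 < σ) (hφ : |φ| ≤ sectorAngle σ) :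
    Real.cos (sectorAngle σ) ≤ Real.cos φ := by
  rw [← Real.cos_abs φ]
  exact Real.cos_le_cos_of_nonneg_of_le_pi (abs_nonneg _)
    (by linarith [sectorAngle_lt hσ, Real.pi_pos]) hφ

theorem cos_mul_of_abs_eq_sectorAngle {φ : ℝ} (hσ : 1 < σ) (hφ : |φ| = sectorAngle σ) :
    Real.cos (σ * φ) = -Real.cos (sectorAngle σ) := by
  have : σ * sectorAngle σ = π - sectorAngle σ := by
    rw [sectorAngle]; field_simp; ring
  rw [← Real.cos_abs, abs_mul, hφ, abs_of_pos (by linarith), this, Real.cos_pi_sub]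

theorem cos_sectorAngle_le_re_exp_hankelContour (hσ : 1 < σ) (u : ℝ) :
    Real.cos (sectorAngle σ) ≤ (Complex.exp (hankelContour (sectorAngle σ) u)).re := by
  rw [Complex.exp_re]
  have h := cos_sectorAngle_le hσ (abs_hankelContour_im_le (sectorAngle_pos hσ).le u)
  exact h.trans (le_mul_of_one_le_left ((cos_sectorAngle_pos hσ).le.trans h)
    (Real.one_le_exp (hankelContour_re_nonneg _ _)))

theorem differentiable_saddleKernel (σ s t ν : ℝ) : Differentiable ℂ (saddleKernel σ s t ν) := by
  unfold saddleKernel; fun_prop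

theorem norm_saddleKernel (σ s t ν x φ : ℝ) :
    ‖saddleKernel σ s t ν (x + φ * Complex.I)‖ =
      Real.exp (-s * (Real.exp x * Real.cos φ) - t * (Real.exp (-x) * Real.cos φ) +
        Real.exp (σ * x) * Real.cos (σ * φ) / σ + ν * x) := by
  rw [saddleKernel, Complex.norm_exp, Complex.add_re, Complex.add_re, Complex.sub_re,
    ← Complex.ofReal_neg, Complex.re_ofReal_mul, Complex.re_ofReal_mul, Complex.div_ofReal_re,
    Complex.re_ofReal_mul, Complex.exp_re, Complex.exp_re, Complex.exp_re]
  simp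

theorem norm_saddleKernel_ray {φ : ℝ} (hσ : 1 < σ) (hφ : |φ| = sectorAngle σ) (s t ν x : ℝ) :
    ‖saddleKernel σ s t ν (x + φ * Complex.I)‖ = Real.exp (ν * x - Real.cos (sectorAngle σ) *
      (s * Real.exp x + t * Real.exp (-x) + Real.exp (σ * x) / σ)) := by
  have hcos : Real.cos φ = Real.cos (sectorAngle σ) := by rw [← Real.cos_abs, hφ]
  rw [norm_saddleKernel, hcos, cos_mul_of_abs_eq_sectorAngle hσ hφ]
  congr 1; ring

theorem norm_saddleKernel_le {s t x φ : ℝ} (hσ : 1 < σ) (hs : 0 ≤ s) (ht : 0 ≤ t)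
    (hφ : |φ| ≤ sectorAngle σ) (ν : ℝ) :
    ‖saddleKernel σ s t ν (x + φ * Complex.I)‖ ≤
      Real.exp (ν * x - Real.cos (sectorAngle σ) * t * Real.exp (-x) +
        Real.exp (σ * x) * Real.cos (σ * φ) / σ) := by
  have hcos := cos_sectorAngle_le hσ hφ
  have hS := cos_sectorAngle_pos hσ
  rw [norm_saddleKernel, Real.exp_le_exp]
  have hsx : 0 ≤ s * (Real.exp x * Real.cos φ) := by have := hS.le.trans hcos; positivity
  have htx : Real.cos (sectorAngle σ) * t * Real.exp (-x) ≤
      t * (Real.exp (-x) * Real.cos φ) := by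
    calc _ = t * (Real.exp (-x) * Real.cos (sectorAngle σ)) := by ring
      _ ≤ _ := by gcongr
  linarith

theorem exists_norm_saddleKernel_hankelContour_le (hσ : 1 < σ) (ν : ℝ) :
    ∃ C : ℝ, ∀ s t u : ℝ, 0 ≤ s → 0 ≤ t →
      ‖saddleKernel σ s t ν (hankelContour (sectorAngle σ) u)‖ ≤ C * Real.exp (-|u|) := by
  have hσ0 : 0 < σ := by linarith
  have hS := cos_sectorAngle_pos hσ
  obtain ⟨C, hC⟩ := exists_mul_sub_exp_le hσ0 (div_pos hS hσ0) ν
  refine ⟨Real.exp (|C| + 1 / σ + sectorAngle σ), fun s t u hs ht => ?_⟩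
  obtain ⟨x, φ, hw, hx, hφ, hu, hcase⟩ := exists_hankelContour_eq (sectorAngle_pos hσ).le u
  rw [hw, ← Real.exp_add]
  refine (norm_saddleKernel_le hσ hs ht hφ ν).trans (Real.exp_le_exp.2 ?_)
  have htx : 0 ≤ Real.cos (sectorAngle σ) * t * Real.exp (-x) := by positivity
  have hσ' : 0 < 1 / σ := by positivity
  have hexp : ν * x + Real.exp (σ * x) * Real.cos (σ * φ) / σ ≤ |C| + 1 / σ - x := by
    rcases hcase with rfl | hφ'
    · have hcos : Real.cos (σ * φ) / σ ≤ 1 / σ := by gcongr; exact Real.cos_le_one _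
      have := abs_nonneg C
      simp only [mul_zero, Real.exp_zero, one_mul, zero_add, sub_zero]
      linarith
    · rw [cos_mul_of_abs_eq_sectorAngle hσ hφ']
      have := hC x hx
      have e : Real.exp (σ * x) * -Real.cos (sectorAngle σ) / σ =
        -(Real.cos (sectorAngle σ) / σ * Real.exp (σ * x)) := by ring
      linarith [le_abs_self C]
  linarith

theorem integrable_saddleKernel_hankelContour (hσ : 1 < σ) (ν : ℝ) {s t : ℝ}
    (hs : 0 ≤ s) (ht : 0 ≤ t) :
    Integrable fun u => saddleKernel σ s t ν (hankelContour (sectorAngle σ) u) := by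
  obtain ⟨C, hC⟩ := exists_norm_saddleKernel_hankelContour_le hσ ν
  exact (integrable_exp_neg_abs.const_mul C).mono'
    ((differentiable_saddleKernel σ s t ν).continuous.comp
      (continuous_hankelContour _)).aestronglyMeasurable
    (Eventually.of_forall fun u => hC s t u hs ht)

theorem exists_norm_saddleIntegral_le (hσ : 1 < σ) (ν : ℝ) :
    ∃ C : ℝ, ∀ s t : ℝ, 0 ≤ s → 0 ≤ t → ‖saddleIntegral σ s t ν‖ ≤ C := by
  obtain ⟨C, hC⟩ := exists_norm_saddleKernel_hankelContour_le hσ ν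
  refine ⟨∫ u : ℝ, C * Real.exp (-|u|), fun s t hs ht => ?_⟩
  refine norm_integral_le_of_norm_le (integrable_exp_neg_abs.const_mul C)
    (Eventually.of_forall fun u => ?_)
  rw [norm_hankelTangent_mul]
  exact hC s t u hs ht

theorem continuousOn_saddleIntegral (hσ : 1 < σ) (ν : ℝ) :
    ContinuousOn (fun s => saddleIntegral σ s 0 ν) (Set.Ici 0) := by
  obtain ⟨C, hC⟩ := exists_norm_saddleKernel_hankelContour_le hσ ν
  refine continuousOn_of_dominated (bound := fun u => C * Real.exp (-|u|))
    (fun s hs => (integrable_hankelTangent_mul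
      (integrable_saddleKernel_hankelContour hσ ν hs le_rfl)).aestronglyMeasurable)
    (fun s hs => Eventually.of_forall fun u => ?_) (integrable_exp_neg_abs.const_mul C)
    (Eventually.of_forall fun u => ?_)
  · rw [norm_hankelTangent_mul]
    exact hC s 0 u hs le_rfl
  · unfold saddleKernel
    fun_prop

theorem hasDerivAt_saddleKernel (σ s ν : ℝ) (w : ℂ) :
    HasDerivAt (fun s => saddleKernel σ s 0 ν w) (-saddleKernel σ s 0 (ν + 1) w) s := by
  have h : HasDerivAt (fun s : ℝ => -(s : ℂ) * Complex.exp w - ((0 : ℝ) : ℂ) * Complex.exp (-w) +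
      Complex.exp ((σ : ℂ) * w) / (σ : ℂ) + (ν : ℂ) * w) (-1 * Complex.exp w) s := by
    have := (Complex.ofRealCLM.hasDerivAt (x := s)).neg.mul_const (Complex.exp w)
    simpa using ((this.sub_const (((0 : ℝ) : ℂ) * Complex.exp (-w))).add_const
      (Complex.exp ((σ : ℂ) * w) / (σ : ℂ))).add_const ((ν : ℂ) * w)
  convert! h.cexp using 1
  rw [neg_one_mul, mul_neg, ← Complex.exp_add, saddleKernel]
  congr 2
  push_cast; ring

theorem hasDerivAt_saddleIntegral (hσ : 1 < σ) (ν : ℝ) {s : ℝ} (hs : 0 < s) :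
    HasDerivAt (fun s => saddleIntegral σ s 0 ν) (-saddleIntegral σ s 0 (ν + 1)) s := by
  obtain ⟨C, hC⟩ := exists_norm_saddleKernel_hankelContour_le hσ (ν + 1)
  have hint (ν' : ℝ) {s' : ℝ} (hs' : 0 < s') := integrable_hankelTangent_mul
    (integrable_saddleKernel_hankelContour hσ ν' hs'.le le_rfl)
  rw [saddleIntegral, hankelIntegral, ← integral_neg]
  refine (hasDerivAt_integral_of_dominated_loc_of_deriv_le
    (F := fun s u => hankelTangent (sectorAngle σ) u *
      saddleKernel σ s 0 ν (hankelContour (sectorAngle σ) u))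
    (F' := fun s u => -(hankelTangent (sectorAngle σ) u *
      saddleKernel σ s 0 (ν + 1) (hankelContour (sectorAngle σ) u)))
    (bound := fun u => C * Real.exp (-|u|)) (Ioi_mem_nhds hs) ?_ (hint ν hs)
    (hint (ν + 1) hs).aestronglyMeasurable.neg
    (Eventually.of_forall fun u s' hs' => ?_) (integrable_exp_neg_abs.const_mul C)
    (Eventually.of_forall fun u s' _ => ?_)).2
  · filter_upwards [Ioi_mem_nhds hs] with s' hs' using (hint ν hs').aestronglyMeasurable
  · rw [norm_neg, norm_hankelTangent_mul]
    exact hC s' 0 u (le_of_lt hs') le_rfl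
  · rw [← mul_neg]
    exact (hasDerivAt_saddleKernel σ s' ν _).const_mul _

theorem integrable_saddleKernel_ray {s t φ : ℝ} (hσ : 1 < σ) (hs : 0 ≤ s) (ht : 0 < t)
    (hφ : |φ| = sectorAngle σ) (ν : ℝ) :
    Integrable fun x : ℝ => saddleKernel σ s t ν (x + φ * Complex.I) := by
  have hσ0 : 0 < σ := by linarith
  have hS := cos_sectorAngle_pos hσ
  obtain ⟨C₁, hC₁⟩ := exists_mul_sub_exp_le hσ0 (div_pos hS hσ0) ν
  obtain ⟨C₂, hC₂⟩ := exists_mul_sub_exp_le one_pos (mul_pos hS ht) (-ν)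
  refine (integrable_exp_neg_abs.const_mul (Real.exp (max C₁ C₂))).mono'
    ((differentiable_saddleKernel σ s t ν).continuous.comp (by fun_prop)).aestronglyMeasurable
    (Eventually.of_forall fun x => ?_)
  rw [norm_saddleKernel_ray hσ hφ, ← Real.exp_add, Real.exp_le_exp]
  have hsx : 0 ≤ Real.cos (sectorAngle σ) * (s * Real.exp x) := by positivity
  have htx : 0 ≤ Real.cos (sectorAngle σ) * t * Real.exp (-x) := by positivity
  have hσx : 0 ≤ Real.cos (sectorAngle σ) / σ * Real.exp (σ * x) := by positivity
  have e : Real.cos (sectorAngle σ) * (Real.exp (σ * x) / σ) =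
    Real.cos (sectorAngle σ) / σ * Real.exp (σ * x) := by ring
  rcases le_total 0 x with hx | hx
  · rw [abs_of_nonneg hx]
    linarith [hC₁ x hx, le_max_left C₁ C₂]
  · rw [abs_of_nonpos hx]
    have := hC₂ (-x) (by linarith)
    rw [one_mul] at this
    linarith [le_max_right C₁ C₂]

theorem tendsto_integral_saddleKernel_atBot {s t : ℝ} (hσ : 1 < σ) (hs : 0 ≤ s) (ht : 0 < t)
    (ν : ℝ) : Tendsto (fun L : ℝ => ∫ y in (-sectorAngle σ)..(sectorAngle σ),
      saddleKernel σ s t ν ((L : ℂ) + y * Complex.I)) atBot (𝓝 0) := by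
  have : 0 < σ := by linarith
  have hS := cos_sectorAngle_pos hσ
  have hθ := sectorAngle_pos hσ
  obtain ⟨C, hC⟩ := exists_mul_sub_exp_le one_pos (mul_pos hS ht) (-ν)
  have hlim : Tendsto (fun L : ℝ => Real.exp (C + 1 / σ + L) *
      |sectorAngle σ - -sectorAngle σ|) atBot (𝓝 0) := by
    rw [← zero_mul |sectorAngle σ - -sectorAngle σ|]
    exact (Real.tendsto_exp_atBot.comp
      (tendsto_atBot_add_const_left _ _ tendsto_id)).mul_const _
  refine squeeze_zero_norm' ?_ hlim
  filter_upwards [eventually_le_atBot 0] with L hL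
  refine intervalIntegral.norm_integral_le_of_norm_le_const fun y hy => ?_
  rw [Set.uIoc_of_le (by linarith)] at hy
  refine (norm_saddleKernel_le hσ hs ht.le (abs_le.2 ⟨hy.1.le, hy.2⟩) ν).trans
    (Real.exp_le_exp.2 ?_)
  have hgrow : Real.exp (σ * L) * Real.cos (σ * y) / σ ≤ 1 / σ := by
    gcongr
    calc _ ≤ Real.exp (σ * L) * 1 := by gcongr; exact Real.cos_le_one _
      _ ≤ 1 := by rw [mul_one, Real.exp_le_one_iff]; nlinarith
  have := hC (-L) (by linarith)
  rw [one_mul] at this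
  linarith

theorem saddleIntegral_eq_integral_sub_integral {s t : ℝ} (hσ : 1 < σ) (hs : 0 ≤ s) (ht : 0 < t)
    (ν : ℝ) : saddleIntegral σ s t ν =
      (∫ x : ℝ, saddleKernel σ s t ν (x + (sectorAngle σ : ℂ) * Complex.I)) -
      ∫ x : ℝ, saddleKernel σ s t ν (x + ((-sectorAngle σ : ℝ) : ℂ) * Complex.I) :=
  hankelIntegral_eq_integral_sub_integral (differentiable_saddleKernel σ s t ν)
    (sectorAngle_pos hσ).le (integrable_saddleKernel_hankelContour hσ ν hs ht.le)
    (fun _ hφ => integrable_saddleKernel_ray hσ hs ht hφ ν)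
    (tendsto_integral_saddleKernel_atBot hσ hs ht ν)

theorem cos_mul_div_sub_cos_le {φ : ℝ} (hσ : 1 < σ) (hφ : |φ| ≤ sectorAngle σ) :
    Real.cos (σ * φ) / σ - Real.cos φ ≤ -(1 - 1 / σ) := by
  have hσ0 : 0 < σ := by linarith
  have hanti : AntitoneOn (fun x : ℝ => Real.cos (σ * x) / σ - Real.cos x)
      (Set.Icc 0 (sectorAngle σ)) := by
    refine antitoneOn_of_hasDerivWithinAt_nonpos (convex_Icc _ _) (by fun_prop)
      (f' := fun x => Real.sin x - Real.sin (σ * x)) (fun x _ => ?_) fun x hx => ?_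
    · refine HasDerivAt.hasDerivWithinAt ?_
      convert! ((((hasDerivAt_id x).const_mul σ).cos).div_const σ).sub
        (Real.hasDerivAt_cos x) using 1
      simp; field_simp; ring
    · rw [interior_Icc] at hx
      have hx1 : σ * x ≤ π - x := by
        have := hx.2
        rw [sectorAngle, lt_div_iff₀ (by linarith)] at this
        linarith
      have hx2 := hx.2.trans (sectorAngle_lt hσ)
      have hx3 : x ≤ σ * x := by nlinarith [hx.1]
      rw [sub_nonpos]
      rcases le_total (σ * x) (π / 2) with h | h
      · exact Real.sin_le_sin_of_le_of_le_pi_div_two (by linarith [hx.1]) h hx3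
      · rw [← Real.sin_pi_sub (σ * x)]
        exact Real.sin_le_sin_of_le_of_le_pi_div_two (by linarith [hx.1]) (by linarith)
          (by linarith)
  have h := hanti (Set.left_mem_Icc.2 (sectorAngle_pos hσ).le) ⟨abs_nonneg φ, hφ⟩ (abs_nonneg φ)
  have e : Real.cos (σ * |φ|) = Real.cos (σ * φ) := by
    rw [← Real.cos_abs (σ * φ), abs_mul, abs_of_pos hσ0]
  simp only [mul_zero, Real.cos_zero, Real.cos_abs, e] at h
  linarith

/-- `w = 0` is the saddle point of the phase `e^(σ w) / σ - e^w`. -/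
theorem re_exp_mul_div_sub_exp_hankelContour_le (hσ : 1 < σ) (u : ℝ) :
    (Complex.exp ((σ : ℂ) * hankelContour (sectorAngle σ) u) / (σ : ℂ) -
      Complex.exp (hankelContour (sectorAngle σ) u)).re ≤ -(1 - 1 / σ) := by
  have hS := cos_sectorAngle_pos hσ
  obtain ⟨x, φ, hw, hx, hφ, -, hcase⟩ := exists_hankelContour_eq (sectorAngle_pos hσ).le u
  have hre : (Complex.exp ((σ : ℂ) * (x + φ * Complex.I)) / (σ : ℂ) -
      Complex.exp (x + φ * Complex.I)).re =
      Real.exp (σ * x) * Real.cos (σ * φ) / σ - Real.exp x * Real.cos φ := by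
    rw [Complex.sub_re, Complex.div_ofReal_re, Complex.exp_re, Complex.exp_re]
    simp
  rw [hw, hre]
  have h0 := cos_mul_div_sub_cos_le hσ hφ
  rcases hcase with rfl | hφ'
  · simpa using h0
  have hcos : Real.cos φ = Real.cos (sectorAngle σ) := by rw [← Real.cos_abs, hφ']
  rw [cos_mul_of_abs_eq_sectorAngle hσ hφ', hcos] at h0 ⊢
  refine le_trans ?_ h0
  have h1 : Real.cos (sectorAngle σ) ≤ Real.exp x * Real.cos (sectorAngle σ) :=
    le_mul_of_one_le_left hS.le (Real.one_le_exp hx)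
  have h2 : Real.cos (sectorAngle σ) / σ ≤ Real.exp (σ * x) * Real.cos (sectorAngle σ) / σ := by
    gcongr
    exact le_mul_of_one_le_left hS.le (Real.one_le_exp (by positivity))
  rw [mul_neg, neg_div, neg_div]
  linarith

theorem re_exp_mul_div_sub_exp_neg_ray_le {φ : ℝ} (hσ : 1 < σ) (hφ : |φ| = sectorAngle σ) (x : ℝ) :
    (Complex.exp ((σ : ℂ) * (x + φ * Complex.I)) / (σ : ℂ) -
      Complex.exp (-(x + φ * Complex.I))).re ≤ -(Real.cos (sectorAngle σ) * (1 + 1 / σ)) := by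
  have : 0 < σ := by linarith
  have hcos : Real.cos φ = Real.cos (sectorAngle σ) := by rw [← Real.cos_abs, hφ]
  have hre : (Complex.exp ((σ : ℂ) * (x + φ * Complex.I)) / (σ : ℂ) -
      Complex.exp (-(x + φ * Complex.I))).re =
      -(Real.cos (sectorAngle σ) * (Real.exp (-x) + Real.exp (σ * x) / σ)) := by
    rw [Complex.sub_re, Complex.div_ofReal_re, Complex.exp_re, Complex.exp_re]
    simp only [Complex.re_ofReal_mul, Complex.im_ofReal_mul, Complex.add_re, Complex.add_im,
      Complex.ofReal_re, Complex.ofReal_im, Complex.I_re, Complex.I_im, mul_zero, mul_one,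
      add_zero, zero_add, Complex.neg_re, Complex.neg_im, Real.cos_neg,
      cos_mul_of_abs_eq_sectorAngle hσ hφ, hcos]
    ring
  rw [hre, neg_le_neg_iff]
  refine mul_le_mul_of_nonneg_left ?_ (cos_sectorAngle_pos hσ).le
  have h1 := Real.add_one_le_exp (-x)
  have h2 : (σ * x + 1) / σ ≤ Real.exp (σ * x) / σ := by
    gcongr; exact Real.add_one_le_exp (σ * x)
  have h3 : (σ * x + 1) / σ = x + 1 / σ := by field_simp
  linarith

theorem saddleKernel_add_log_div_sub_one {s : ℝ} (hσ : 1 < σ) (hs : 0 < s) (ν : ℝ) (w : ℂ) :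
    saddleKernel σ s 0 ν (w + (Real.log s / (σ - 1) : ℝ)) =
      ((s ^ (ν / (σ - 1)) : ℝ) : ℂ) * (Complex.exp (((s ^ (σ / (σ - 1)) - 1 : ℝ) : ℂ) *
        (Complex.exp ((σ : ℂ) * w) / (σ : ℂ) - Complex.exp w)) * saddleKernel σ 1 0 ν w) := by
  have hσ1 : σ - 1 ≠ 0 := by linarith
  set L := Real.log s / (σ - 1) with hL
  have hνL : s ^ (ν / (σ - 1)) = Real.exp (ν * L) := by
    rw [Real.rpow_def_of_pos hs, hL]; congr 1; ring
  have hσL : s ^ (σ / (σ - 1)) = Real.exp (σ * L) := by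
    rw [Real.rpow_def_of_pos hs, hL]; congr 1; ring
  have hsL : (s : ℂ) * Complex.exp L = Complex.exp (σ * L) := by
    norm_cast
    nth_rewrite 1 [← Real.exp_log hs]
    rw [← Real.exp_add, hL]
    congr 1; field_simp; ring
  rw [hνL, hσL, saddleKernel, saddleKernel]
  push_cast
  rw [← Complex.exp_add, ← Complex.exp_add]
  congr 1
  rw [mul_add (σ : ℂ), Complex.exp_add w, Complex.exp_add ((σ : ℂ) * w)]
  linear_combination -Complex.exp w * hsL

theorem saddleKernel_add_log_div_add_one {t : ℝ} (hσ : 1 < σ) (ht : 0 < t) (ν : ℝ) (w : ℂ) :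
    saddleKernel σ 0 t ν (w + (Real.log t / (σ + 1) : ℝ)) =
      ((t ^ (ν / (σ + 1)) : ℝ) : ℂ) * (Complex.exp (((t ^ (σ / (σ + 1)) - 1 : ℝ) : ℂ) *
        (Complex.exp ((σ : ℂ) * w) / (σ : ℂ) - Complex.exp (-w))) * saddleKernel σ 0 1 ν w) := by
  have hσ1 : σ + 1 ≠ 0 := by linarith
  set L := Real.log t / (σ + 1) with hL
  have hνL : t ^ (ν / (σ + 1)) = Real.exp (ν * L) := by
    rw [Real.rpow_def_of_pos ht, hL]; congr 1; ring
  have hσL : t ^ (σ / (σ + 1)) = Real.exp (σ * L) := by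
    rw [Real.rpow_def_of_pos ht, hL]; congr 1; ring
  have htL : (t : ℂ) * Complex.exp (-L) = Complex.exp (σ * L) := by
    norm_cast
    nth_rewrite 1 [← Real.exp_log ht]
    rw [← Real.exp_add, hL]
    congr 1; field_simp; ring
  rw [hνL, hσL, saddleKernel, saddleKernel]
  push_cast
  rw [← Complex.exp_add, ← Complex.exp_add]
  congr 1
  rw [mul_add (σ : ℂ), neg_add, Complex.exp_add (-w), Complex.exp_add ((σ : ℂ) * w)]
  linear_combination -Complex.exp (-w) * htL

end

section

variable {s k B C M N κ : ℝ}

theorem rpow_le_two_rpow_mul_one_add_rpow_neg (hN : 0 ≤ N) (hM : M ≤ -N) (hs : 1 ≤ s) :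
    s ^ M ≤ 2 ^ N * (1 + s) ^ (-N) :=
  calc s ^ M ≤ s ^ (-N) := Real.rpow_le_rpow_of_exponent_le hs hM
    _ ≤ ((1 + s) / 2) ^ (-N) :=
      Real.rpow_le_rpow_of_nonpos (by linarith) (by linarith) (by linarith)
    _ = 2 ^ N * (1 + s) ^ (-N) := by
      rw [Real.div_rpow (by linarith) two_pos.le, Real.rpow_neg two_pos.le, div_inv_eq_mul,
        mul_comm]

theorem one_le_two_rpow_mul_one_add_rpow_neg (hN : 0 ≤ N) (hs : 0 ≤ s) (hs1 : s ≤ 1) :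
    1 ≤ 2 ^ N * (1 + s) ^ (-N) := by
  have h1s : 0 < 1 + s := by linarith
  rw [Real.rpow_neg h1s.le, ← div_eq_mul_inv, ← Real.div_rpow two_pos.le h1s.le]
  exact Real.one_le_rpow (by rw [le_div_iff₀ h1s]; linarith) hN

theorem exists_norm_le_rpow_neg_mul_exp {F : Type*} [SeminormedAddCommGroup F] {G : ℝ → F}
    (hN : 0 ≤ N) (hk : 0 ≤ k) (hκ : 0 ≤ κ) (hM : M ≤ -N) (hB : ∀ s, 0 ≤ s → ‖G s‖ ≤ B)
    (hC : ∀ s, 1 ≤ s → ‖G s‖ ≤ s ^ M * (Real.exp ((s ^ κ - 1) * -k) * C)) :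
    ∃ D : ℝ, ∀ s, 0 ≤ s → ‖G s‖ ≤ D * (1 + s) ^ (-N) * Real.exp (-k * s ^ κ) := by
  have hB0 : 0 ≤ B := (norm_nonneg _).trans (hB 0 le_rfl)
  refine ⟨max B C * 2 ^ N * Real.exp k, fun s hs => ?_⟩
  have : 0 < 1 + s := by linarith
  have : 0 ≤ max B C := le_max_of_le_left hB0
  have hexp : Real.exp ((s ^ κ - 1) * -k) = Real.exp k * Real.exp (-k * s ^ κ) := by
    rw [← Real.exp_add]; ring_nf
  suffices h : ‖G s‖ ≤ 2 ^ N * (1 + s) ^ (-N) * (Real.exp ((s ^ κ - 1) * -k) * max B C) by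
    rw [hexp] at h
    linarith
  rcases le_total 1 s with h | h
  · calc ‖G s‖ ≤ s ^ M * (Real.exp ((s ^ κ - 1) * -k) * C) := hC s h
      _ ≤ s ^ M * (Real.exp ((s ^ κ - 1) * -k) * max B C) := by
        gcongr; exact le_max_right B C
      _ ≤ _ := by
        gcongr; exact rpow_le_two_rpow_mul_one_add_rpow_neg hN hM h
  · have hexp1 : 1 ≤ Real.exp ((s ^ κ - 1) * -k) :=
      Real.one_le_exp (mul_nonneg_of_nonpos_of_nonpos
        (sub_nonpos.2 (Real.rpow_le_one hs h hκ)) (neg_nonpos.2 hk))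
    calc ‖G s‖ ≤ 1 * (1 * max B C) := by simpa using Or.inl (hB s hs)
      _ ≤ _ := by
        gcongr
        exact one_le_two_rpow_mul_one_add_rpow_neg hN hs h

end

theorem norm_exp_ofReal_mul_le {r c : ℝ} {z : ℂ} (hr : 0 ≤ r) (hz : z.re ≤ c) :
    ‖Complex.exp ((r : ℂ) * z)‖ ≤ Real.exp (r * c) := by
  rw [Complex.norm_exp, Complex.re_ofReal_mul]
  gcongr

section

variable {σ s t ν N : ℝ}

theorem norm_saddleKernel_hankelContour_add_log_le (hσ : 1 < σ) (hs : 1 ≤ s) (ν u : ℝ) :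
    ‖saddleKernel σ s 0 ν
        (hankelContour (sectorAngle σ) u + (Real.log s / (σ - 1) : ℝ))‖ ≤
      s ^ (ν / (σ - 1)) * (Real.exp ((s ^ (σ / (σ - 1)) - 1) * -(1 - 1 / σ)) *
        ‖saddleKernel σ 1 0 ν (hankelContour (sectorAngle σ) u)‖) := by
  have hs0 : 0 < s := by linarith
  have hκ : 0 ≤ σ / (σ - 1) := div_nonneg (by linarith) (by linarith)
  rw [saddleKernel_add_log_div_sub_one hσ hs0, norm_mul, norm_mul, Complex.norm_real,
    Real.norm_of_nonneg (by positivity)]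
  gcongr
  exact norm_exp_ofReal_mul_le (sub_nonneg.2 (Real.one_le_rpow hs hκ))
    (re_exp_mul_div_sub_exp_hankelContour_le hσ u)

theorem norm_saddleKernel_ray_add_log_le {φ : ℝ} (hσ : 1 < σ) (ht : 1 ≤ t)
    (hφ : |φ| = sectorAngle σ) (ν x : ℝ) :
    ‖saddleKernel σ 0 t ν (x + φ * Complex.I + (Real.log t / (σ + 1) : ℝ))‖ ≤
      t ^ (ν / (σ + 1)) * (Real.exp ((t ^ (σ / (σ + 1)) - 1) *
        -(Real.cos (sectorAngle σ) * (1 + 1 / σ))) *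
        ‖saddleKernel σ 0 1 ν (x + φ * Complex.I)‖) := by
  have ht0 : 0 < t := by linarith
  have hκ : 0 ≤ σ / (σ + 1) := div_nonneg (by linarith) (by linarith)
  rw [saddleKernel_add_log_div_add_one hσ ht0, norm_mul, norm_mul, Complex.norm_real,
    Real.norm_of_nonneg (by positivity)]
  gcongr
  exact norm_exp_ofReal_mul_le (sub_nonneg.2 (Real.one_le_rpow ht hκ))
    (re_exp_mul_div_sub_exp_neg_ray_le hσ hφ x)

theorem norm_saddleIntegral_zero_right_le (hσ : 1 < σ) (hs : 1 ≤ s) (ν : ℝ) :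
    ‖saddleIntegral σ s 0 ν‖ ≤
      s ^ (ν / (σ - 1)) * (Real.exp ((s ^ (σ / (σ - 1)) - 1) * -(1 - 1 / σ)) *
        ∫ u, ‖saddleKernel σ 1 0 ν (hankelContour (sectorAngle σ) u)‖) := by
  have hs0 : 0 ≤ s := by linarith
  have hdiff := differentiable_saddleKernel σ s 0 ν
  have hθ := (sectorAngle_pos hσ).le
  have hbound := fun u => norm_saddleKernel_hankelContour_add_log_le hσ hs ν u
  have hint := ((integrable_saddleKernel_hankelContour hσ ν zero_le_one le_rfl).norm.const_mul
    (Real.exp ((s ^ (σ / (σ - 1)) - 1) * -(1 - 1 / σ)))).const_mul (s ^ (ν / (σ - 1)))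
  have hshift : Integrable fun u => saddleKernel σ s 0 ν
      (hankelContour (sectorAngle σ) u + (Real.log s / (σ - 1) : ℝ)) :=
    hint.mono' (hdiff.continuous.comp
      ((continuous_hankelContour _).add continuous_const)).aestronglyMeasurable
      (Eventually.of_forall hbound)
  rw [saddleIntegral, ← hankelIntegral_comp_add_ofReal hdiff hθ
    (integrable_saddleKernel_hankelContour hσ ν hs0 le_rfl) _ hshift, ← integral_const_mul,
    ← integral_const_mul]
  refine norm_integral_le_of_norm_le hint (Eventually.of_forall fun u => ?_)
  rw [norm_hankelTangent_mul]
  exact hbound u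

theorem norm_integral_saddleKernel_ray_le {φ : ℝ} (hσ : 1 < σ) (ht : 1 ≤ t)
    (hφ : |φ| = sectorAngle σ) (ν : ℝ) :
    ‖∫ x : ℝ, saddleKernel σ 0 t ν (x + φ * Complex.I)‖ ≤
      t ^ (ν / (σ + 1)) * (Real.exp ((t ^ (σ / (σ + 1)) - 1) *
        -(Real.cos (sectorAngle σ) * (1 + 1 / σ))) *
        ∫ x : ℝ, ‖saddleKernel σ 0 1 ν (x + φ * Complex.I)‖) := by
  rw [← integral_add_right_eq_self _ (Real.log t / (σ + 1)), ← integral_const_mul,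
    ← integral_const_mul]
  refine norm_integral_le_of_norm_le (((integrable_saddleKernel_ray hσ le_rfl one_pos hφ
    ν).norm.const_mul _).const_mul _) (Eventually.of_forall fun x => ?_)
  simpa only [Complex.ofReal_add, add_right_comm] using
    norm_saddleKernel_ray_add_log_le hσ ht hφ ν x

theorem exists_norm_saddleIntegral_zero_right_le (hσ : 1 < σ) (hN : 0 ≤ N)
    (hν : ν ≤ -N * (σ - 1)) : ∃ D : ℝ, ∀ s, 0 ≤ s → ‖saddleIntegral σ s 0 ν‖ ≤
      D * (1 + s) ^ (-N) * Real.exp (-(1 - 1 / σ) * s ^ (σ / (σ - 1))) := by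
  have hσ1 : 0 < σ - 1 := by linarith
  obtain ⟨B, hB⟩ := exists_norm_saddleIntegral_le hσ ν
  refine exists_norm_le_rpow_neg_mul_exp hN ?_ (by positivity) ((div_le_iff₀ hσ1).2 hν)
    (fun s hs => hB s 0 hs le_rfl) fun s hs => norm_saddleIntegral_zero_right_le hσ hs ν
  rw [sub_nonneg, div_le_one (by linarith)]
  exact hσ.le

theorem exists_norm_saddleIntegral_zero_left_le (hσ : 1 < σ) (hN : 0 ≤ N)
    (hν : ν ≤ -N * (σ + 1)) : ∃ D : ℝ, ∀ t, 0 ≤ t → ‖saddleIntegral σ 0 t ν‖ ≤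
      D * (1 + t) ^ (-N) *
        Real.exp (-(Real.cos (sectorAngle σ) * (1 + 1 / σ)) * t ^ (σ / (σ + 1))) := by
  have hσ1 : 0 < σ + 1 := by linarith
  have hcos := cos_sectorAngle_pos hσ
  have hpos : |sectorAngle σ| = sectorAngle σ := abs_of_pos (sectorAngle_pos hσ)
  have hneg : |-sectorAngle σ| = sectorAngle σ := by rw [abs_neg, hpos]
  obtain ⟨B, hB⟩ := exists_norm_saddleIntegral_le hσ ν
  refine exists_norm_le_rpow_neg_mul_exp hN (by positivity) (by positivity)
    ((div_le_iff₀ hσ1).2 hν) (fun t ht => hB 0 t le_rfl ht) (C :=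
      (∫ x : ℝ, ‖saddleKernel σ 0 1 ν (x + sectorAngle σ * Complex.I)‖) +
        ∫ x : ℝ, ‖saddleKernel σ 0 1 ν (x + (-sectorAngle σ : ℝ) * Complex.I)‖) fun t ht => ?_
  rw [saddleIntegral_eq_integral_sub_integral hσ le_rfl (by linarith), mul_add, mul_add]
  exact norm_sub_le_of_le (norm_integral_saddleKernel_ray_le hσ ht hpos ν)
    (norm_integral_saddleKernel_ray_le hσ ht hneg ν)

end

theorem cpow_pi_div_mul_exp {ℓ : ℝ} (hℓ : 0 < ℓ) {w : ℂ} (hw : |w.im| < π) (c : ℝ) :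
    ((π : ℂ) / ((ℓ : ℂ) * Complex.exp w)) ^ (c : ℂ) =
      (((π / ℓ) ^ c : ℝ) : ℂ) * Complex.exp (-(c : ℂ) * w) := by
  have hr : 0 < π / ℓ := div_pos Real.pi_pos hℓ
  have hquot : (π : ℂ) / ((ℓ : ℂ) * Complex.exp w) =
      ((π / ℓ : ℝ) : ℂ) * Complex.exp (-w) := by
    rw [Complex.exp_neg]; push_cast; field_simp
  have hw' := abs_lt.1 hw
  rw [hquot, Complex.cpow_def_of_ne_zero
    (mul_ne_zero (Complex.ofReal_ne_zero.2 hr.ne') (Complex.exp_ne_zero _)),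
    Complex.log_ofReal_mul hr (Complex.exp_ne_zero _),
    Complex.log_exp (by rw [Complex.neg_im]; linarith) (by rw [Complex.neg_im]; linarith),
    add_mul, Complex.exp_add, Real.rpow_def_of_pos hr, Complex.ofReal_exp]
  push_cast
  congr 2; ring

section

variable {n : ℕ} {σ ℓ : ℝ}

theorem fourierHat_exp_neg_mul_exp (hℓ : 0 < ℓ) {w : ℂ} (hw : |w.im| < π / 2)
    (y : EuclideanSpace ℝ (Fin n)) :
    fourierHat (fun x : EuclideanSpace ℝ (Fin n) =>
        Complex.exp (-((ℓ * ‖x‖ ^ 2 : ℝ) : ℂ) * Complex.exp w)) y =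
      (((π / ℓ) ^ ((n : ℝ) / 2) : ℝ) : ℂ) * (Complex.exp (-(((n : ℝ) / 2 : ℝ) : ℂ) * w) *
        Complex.exp (-((‖y‖ ^ 2 / (4 * ℓ) : ℝ) : ℂ) * Complex.exp (-w))) := by
  have hre : 0 < ((ℓ : ℂ) * Complex.exp w).re := by
    rw [Complex.re_ofReal_mul, Complex.exp_re]
    exact mul_pos hℓ (mul_pos (Real.exp_pos _) (Real.cos_pos_of_mem_Ioo (abs_lt.1 hw)))
  have hgauss := GaussianFourier.integral_cexp_neg_mul_sq_norm_add hre (-Complex.I) y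
  have hexp : (-Complex.I) ^ 2 * (‖y‖ : ℂ) ^ 2 / (4 * ((ℓ : ℂ) * Complex.exp w)) =
      -((‖y‖ ^ 2 / (4 * ℓ) : ℝ) : ℂ) * Complex.exp (-w) := by
    rw [Complex.exp_neg, neg_sq, Complex.I_sq]
    push_cast
    field_simp
  have hdim : (n : ℂ) / 2 = (((n : ℝ) / 2 : ℝ) : ℂ) := by push_cast; rfl
  rw [finrank_euclideanSpace, Fintype.card_fin, hdim,
    cpow_pi_div_mul_exp hℓ (hw.trans (by linarith [Real.pi_pos])), hexp] at hgauss
  rw [fourierHat, ← mul_assoc, ← hgauss]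
  congr 1 with x
  rw [← Complex.exp_add, real_inner_comm]
  push_cast
  ring_nf

theorem saddleKernel_eq_exp_mul (σ s ν : ℝ) (w : ℂ) :
    saddleKernel σ s 0 ν w =
      Complex.exp (-(s : ℂ) * Complex.exp w) * saddleKernel σ 0 0 ν w := by
  rw [saddleKernel, saddleKernel, ← Complex.exp_add]
  push_cast
  ring_nf

theorem saddleKernel_sub (σ t ν c : ℝ) (w : ℂ) :
    saddleKernel σ 0 t (ν - c) w = saddleKernel σ 0 0 ν w *
      (Complex.exp (-(c : ℂ) * w) * Complex.exp (-(t : ℂ) * Complex.exp (-w))) := by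
  rw [saddleKernel, saddleKernel, ← Complex.exp_add, ← Complex.exp_add]
  push_cast
  ring_nf

theorem integrable_saddleKernel_mul_exp_inner (hσ : 1 < σ) (hℓ : 0 < ℓ) (ν : ℝ)
    (y : EuclideanSpace ℝ (Fin n)) :
    Integrable (Function.uncurry fun (x : EuclideanSpace ℝ (Fin n)) (u : ℝ) =>
      hankelTangent (sectorAngle σ) u *
        saddleKernel σ (ℓ * ‖x‖ ^ 2) 0 ν (hankelContour (sectorAngle σ) u) *
        Complex.exp (-Complex.I * ((inner ℝ x y : ℝ) : ℂ))) (volume.prod volume) := by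
  have hcos := cos_sectorAngle_pos hσ
  have hgauss : Integrable fun x : EuclideanSpace ℝ (Fin n) =>
      Real.exp (-(ℓ * Real.cos (sectorAngle σ)) * ‖x‖ ^ 2) := by
    have hre : 0 < ((ℓ * Real.cos (sectorAngle σ) : ℝ) : ℂ).re := mul_pos hℓ hcos
    refine (GaussianFourier.integrable_cexp_neg_mul_sq_norm_add hre 0
      (0 : EuclideanSpace ℝ (Fin n))).norm.congr (Eventually.of_forall fun x => ?_)
    simp only [zero_mul, add_zero]
    rw [← Complex.ofReal_neg, ← Complex.ofReal_pow, ← Complex.ofReal_mul,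
      Complex.norm_exp_ofReal]
  have hcontour := continuous_hankelContour (sectorAngle σ)
  refine (hgauss.mul_prod (integrable_saddleKernel_hankelContour hσ ν le_rfl le_rfl).norm).mono'
    (AEStronglyMeasurable.mul (AEStronglyMeasurable.mul
      ((measurable_hankelTangent _).comp measurable_snd).aestronglyMeasurable ?_) ?_)
    (Eventually.of_forall fun z => ?_)
  · unfold saddleKernel
    exact Continuous.aestronglyMeasurable (by fun_prop)
  · exact Continuous.aestronglyMeasurable (by fun_prop)
  · have hphase : ‖Complex.exp (-Complex.I * ((inner ℝ z.1 y : ℝ) : ℂ))‖ = 1 := by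
      rw [Complex.norm_exp]; simp
    have hre := mul_le_mul_of_nonneg_left (cos_sectorAngle_le_re_exp_hankelContour hσ z.2)
      (by positivity : 0 ≤ ℓ * ‖z.1‖ ^ 2)
    rw [Function.uncurry, norm_mul, hphase, mul_one, norm_hankelTangent_mul,
      saddleKernel_eq_exp_mul, norm_mul, Complex.norm_exp, ← Complex.ofReal_neg,
      Complex.re_ofReal_mul]
    refine mul_le_mul_of_nonneg_right (Real.exp_le_exp.2 ?_) (norm_nonneg _)
    linarith

theorem fourierHat_saddleIntegral (hσ : 1 < σ) (hℓ : 0 < ℓ) (ν : ℝ)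
    (y : EuclideanSpace ℝ (Fin n)) :
    fourierHat (fun x : EuclideanSpace ℝ (Fin n) => saddleIntegral σ (ℓ * ‖x‖ ^ 2) 0 ν) y =
      (((π / ℓ) ^ ((n : ℝ) / 2) : ℝ) : ℂ) *
        saddleIntegral σ 0 (‖y‖ ^ 2 / (4 * ℓ)) (ν - (n : ℝ) / 2) := by
  simp only [fourierHat, saddleIntegral, hankelIntegral, ← integral_mul_const]
  rw [integral_integral_swap (integrable_saddleKernel_mul_exp_inner hσ hℓ ν y),
    ← integral_const_mul]
  congr 1 with u
  have him : |(hankelContour (sectorAngle σ) u).im| < π / 2 :=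
    (abs_hankelContour_im_le (sectorAngle_pos hσ).le u).trans_lt (sectorAngle_lt hσ)
  have hfactor : ∀ x : EuclideanSpace ℝ (Fin n),
      hankelTangent (sectorAngle σ) u *
          saddleKernel σ (ℓ * ‖x‖ ^ 2) 0 ν (hankelContour (sectorAngle σ) u) *
          Complex.exp (-Complex.I * ((inner ℝ x y : ℝ) : ℂ)) =
        hankelTangent (sectorAngle σ) u *
          saddleKernel σ 0 0 ν (hankelContour (sectorAngle σ) u) *
          (Complex.exp (-((ℓ * ‖x‖ ^ 2 : ℝ) : ℂ) *
              Complex.exp (hankelContour (sectorAngle σ) u)) *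
            Complex.exp (-Complex.I * ((inner ℝ x y : ℝ) : ℂ))) := fun x => by
    rw [saddleKernel_eq_exp_mul]
    ring
  have hgauss := fourierHat_exp_neg_mul_exp hℓ him y
  rw [fourierHat] at hgauss
  simp only [hfactor]
  rw [integral_const_mul, hgauss, saddleKernel_sub]
  ring

end

section

variable {σ φ : ℝ}

theorem cos_mul_le_neg_cos_sectorAngle (hσ : 1 < σ) (hφ : sectorAngle σ ≤ |φ|)
    (hφ' : |φ| ≤ π / σ) : Real.cos (σ * φ) ≤ -Real.cos (sectorAngle σ) := by
  have hσ0 : 0 < σ := by linarith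
  rw [← cos_mul_of_abs_eq_sectorAngle hσ (abs_of_pos (sectorAngle_pos hσ)), ← Real.cos_abs,
    abs_mul, abs_of_pos hσ0]
  have hπ : σ * |φ| ≤ π := by rwa [le_div_iff₀' hσ0] at hφ'
  exact Real.cos_le_cos_of_nonneg_of_le_pi (mul_nonneg hσ0.le (sectorAngle_pos hσ).le) hπ
    (by gcongr)

theorem exists_norm_saddleKernel_zero_le (hσ : 1 < σ) :
    ∃ C : ℝ, ∀ x φ : ℝ, 0 ≤ x → sectorAngle σ ≤ |φ| → |φ| ≤ π / σ →
      ‖saddleKernel σ 0 0 0 (x + φ * Complex.I)‖ ≤ C * Real.exp (-x) := by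
  have hσ0 : 0 < σ := by linarith
  obtain ⟨C, hC⟩ := exists_mul_sub_exp_le hσ0 (div_pos (cos_sectorAngle_pos hσ) hσ0) 0
  refine ⟨Real.exp C, fun x φ hx hφ hφ' => ?_⟩
  have hcos : Real.exp (σ * x) * Real.cos (σ * φ) / σ ≤
      Real.exp (σ * x) * -Real.cos (sectorAngle σ) / σ := by
    gcongr
    exact cos_mul_le_neg_cos_sectorAngle hσ hφ hφ'
  have hcomm : Real.exp (σ * x) * -Real.cos (sectorAngle σ) / σ =
      -(Real.cos (sectorAngle σ) / σ * Real.exp (σ * x)) := by ring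
  rw [norm_saddleKernel, ← Real.exp_add, Real.exp_le_exp]
  linarith [hC x hx]

theorem integrableOn_saddleKernel_zero (hσ : 1 < σ) (hφ : sectorAngle σ ≤ |φ|)
    (hφ' : |φ| ≤ π / σ) :
    IntegrableOn (fun x : ℝ => saddleKernel σ 0 0 0 (x + φ * Complex.I)) (Set.Ioi 0) := by
  obtain ⟨C, hC⟩ := exists_norm_saddleKernel_zero_le hσ
  exact ((integrableOn_exp_neg_Ioi 0).const_mul C).mono'
    ((differentiable_saddleKernel σ 0 0 0).continuous.comp (by fun_prop)).aestronglyMeasurable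
    (ae_restrict_of_forall_mem measurableSet_Ioi fun x hx => hC x φ (le_of_lt hx) hφ hφ')

theorem integral_Ioi_saddleKernel_sub {c d : ℝ} (hσ : 1 < σ)
    (h : ∀ φ ∈ Set.uIcc c d, sectorAngle σ ≤ |φ| ∧ |φ| ≤ π / σ) :
    (∫ x in Set.Ioi (0 : ℝ), saddleKernel σ 0 0 0 (x + c * Complex.I)) -
        ∫ x in Set.Ioi (0 : ℝ), saddleKernel σ 0 0 0 (x + d * Complex.I) =
      Complex.I * ∫ y in c..d, saddleKernel σ 0 0 0 ((0 : ℝ) + y * Complex.I) := by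
  obtain ⟨C, hC⟩ := exists_norm_saddleKernel_zero_le hσ
  have hc := h c Set.left_mem_uIcc
  have hd := h d Set.right_mem_uIcc
  refine integral_Ioi_sub_integral_Ioi_eq (differentiable_saddleKernel σ 0 0 0)
    (integrableOn_saddleKernel_zero hσ hc.1 hc.2) (integrableOn_saddleKernel_zero hσ hd.1 hd.2) ?_
  have hexp : Tendsto (fun R => C * Real.exp (-R) * |d - c|) atTop (𝓝 0) := by
    simpa using (Real.tendsto_exp_neg_atTop_nhds_zero.const_mul C).mul_const |d - c|
  refine squeeze_zero_norm' ?_ hexp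
  filter_upwards [eventually_ge_atTop 0] with R hR
  refine intervalIntegral.norm_integral_le_of_norm_le_const fun y hy => ?_
  have hy' := h y (Set.uIoc_subset_uIcc hy)
  exact hC R y hR hy'.1 hy'.2

theorem integral_saddleKernel_zero_vertical (hσ : 0 < σ) :
    ∫ y in (-(π / σ))..(π / σ), saddleKernel σ 0 0 0 ((0 : ℝ) + y * Complex.I) = 2 * π / σ := by
  have hdiff : Differentiable ℂ fun z : ℂ => Complex.exp (z / σ) := by fun_prop
  have hmean : ∫ φ in (-π)..π, Complex.exp (circleMap 0 1 φ / σ) = 2 * π := by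
    have h := (hdiff.diffContOnCl (s := Metric.ball 0 |1|)).circleAverage
    rw [Real.circleAverage_eq_integral_add (-π),
      intervalIntegral.integral_comp_add_right fun φ => Complex.exp (circleMap 0 1 φ / σ),
      inv_smul_eq_iff₀ Real.two_pi_pos.ne'] at h
    convert h using 2
    · ring
    · ring
    · simp
  have hscale := intervalIntegral.integral_comp_mul_left (a := -(π / σ)) (b := π / σ)
    (fun φ => Complex.exp (circleMap 0 1 φ / σ)) hσ.ne'
  rw [mul_neg, mul_div_cancel₀ _ hσ.ne', hmean] at hscale
  convert hscale using 2
  · ext y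
    simp [saddleKernel, circleMap, mul_assoc]
  · rw [Complex.real_smul]; push_cast; ring

theorem saddleKernel_zero_periodic (hσ : 0 < σ) (x : ℝ) :
    saddleKernel σ 0 0 0 (x + (π / σ : ℝ) * Complex.I) =
      saddleKernel σ 0 0 0 (x + (-(π / σ) : ℝ) * Complex.I) := by
  have hσ' : (σ : ℂ) ≠ 0 := Complex.ofReal_ne_zero.2 hσ.ne'
  have hshift : (σ : ℂ) * (x + (π / σ : ℝ) * Complex.I) =
      σ * (x + (-(π / σ) : ℝ) * Complex.I) + 2 * π * Complex.I := by
    push_cast; field_simp; ring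
  have hexp : Complex.exp (σ * (x + (π / σ : ℝ) * Complex.I)) =
      Complex.exp (σ * (x + (-(π / σ) : ℝ) * Complex.I)) := by
    rw [hshift]; exact Complex.exp_periodic _
  simp only [saddleKernel, hexp, Complex.ofReal_zero, neg_zero, zero_mul]

theorem saddleIntegral_zero (hσ : 1 < σ) :
    saddleIntegral σ 0 0 0 = 2 * π * Complex.I / σ := by
  have hσ0 : 0 < σ := by linarith
  have hθ := sectorAngle_pos hσ
  have hθη : sectorAngle σ ≤ π / σ :=
    div_le_div_of_nonneg_left Real.pi_pos.le hσ0 (by linarith)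
  have hright := integral_Ioi_saddleKernel_sub (c := sectorAngle σ) (d := π / σ) hσ fun φ hφ => by
    rw [Set.uIcc_of_le hθη] at hφ
    rwa [abs_of_nonneg (hθ.le.trans hφ.1)]
  have hleft := integral_Ioi_saddleKernel_sub (c := -(π / σ)) (d := -sectorAngle σ) hσ
    fun φ hφ => by
      rw [Set.uIcc_of_le (neg_le_neg hθη)] at hφ
      rw [abs_of_nonpos (hφ.2.trans (neg_nonpos.2 hθ.le))]
      exact ⟨le_neg.1 hφ.2, neg_le.1 hφ.1⟩
  have hcont : Continuous fun y : ℝ => saddleKernel σ 0 0 0 ((0 : ℝ) + y * Complex.I) :=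
    (differentiable_saddleKernel σ 0 0 0).continuous.comp (by fun_prop)
  have hint := fun a b => hcont.intervalIntegrable (μ := volume) a b
  have htotal := integral_saddleKernel_zero_vertical hσ0
  rw [← intervalIntegral.integral_add_adjacent_intervals (hint _ (sectorAngle σ)) (hint _ _),
    ← intervalIntegral.integral_add_adjacent_intervals (hint (-(π / σ)) (-sectorAngle σ))
      (hint _ _)]
    at htotal
  simp only [saddleKernel_zero_periodic hσ0] at hright
  rw [saddleIntegral, hankelIntegral_eq_sum hθ.le
    (integrable_saddleKernel_hankelContour hσ 0 le_rfl le_rfl)]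
  linear_combination hright + hleft + Complex.I * htotal

end

theorem tendsto_zero_of_norm_le_exp_neg {E : Type*} [SeminormedAddCommGroup E] {F : ℝ → E} {C : ℝ}
    (hF : ∀ s, 0 < s → ‖F s‖ ≤ C * Real.exp (-s)) : Tendsto F atTop (𝓝 0) := by
  refine squeeze_zero_norm' ((eventually_gt_atTop 0).mono hF) ?_
  simpa using Real.tendsto_exp_neg_atTop_nhds_zero.const_mul C

section

variable {𝕜 E : Type*} [NormedField 𝕜] [NormedAddCommGroup E] [NormedSpace ℝ E]
  [NormedSpace 𝕜 E] {u : ℕ → ℝ → E}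

theorem norm_le_div_mul_exp_neg_of_hasDerivAt_neg {F f : ℝ → E} {K M : ℝ} (hK : 0 < K)
    (hF : ∀ s, 0 < s → HasDerivAt F (-f s) s) (hF0 : Tendsto F atTop (𝓝 0))
    (hf : ∀ s, 0 < s → ‖f s‖ ≤ M * Real.exp (-K * s)) {s : ℝ} (hs : 0 < s) :
    ‖F s‖ ≤ M / K * Real.exp (-K * s) := by
  have hB (x : ℝ) : HasDerivAt (fun x => M / K * (Real.exp (-K * s) - Real.exp (-K * x)))
      (M * Real.exp (-K * x)) x := by
    refine ((((hasDerivAt_id' x).const_mul (-K)).exp.const_sub _).const_mul (M / K)).congr_deriv ?_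
    field_simp
  have hbound : ∀ᶠ R in atTop, ‖F R - F s‖ ≤ M / K * (Real.exp (-K * s) - Real.exp (-K * R)) := by
    filter_upwards [eventually_ge_atTop s] with R hR
    have hd : ∀ x ∈ Set.Icc s R, HasDerivAt (fun x => F x - F s) (-f x) x := fun x hx =>
      (hF x (hs.trans_le hx.1)).sub_const _
    refine image_norm_le_of_norm_deriv_right_le_deriv_boundary
      (fun x hx => (hd x hx).continuousAt.continuousWithinAt)
      (fun x hx => (hd x (Set.Ico_subset_Icc_self hx)).hasDerivWithinAt) (by simp) hB
      (fun x hx => ?_) ⟨hR, le_rfl⟩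
    simpa only [norm_neg] using hf x (hs.trans_le hx.1)
  have hexp : Tendsto (fun R => Real.exp (-K * R)) atTop (𝓝 0) :=
    Real.tendsto_exp_atBot.comp (tendsto_id.const_mul_atTop_of_neg (neg_lt_zero.2 hK))
  simpa using le_of_tendsto_of_tendsto (hF0.sub_const (F s)).norm
    ((hexp.const_sub (Real.exp (-K * s))).const_mul (M / K)) hbound

theorem norm_add_le_div_pow_mul_exp_neg {K M : ℝ} {k : ℕ} (hK : 0 < K)
    (hu : ∀ j s, 0 < s → HasDerivAt (u (j + 1)) (-u j s) s)
    (hu0 : ∀ j, Tendsto (u j) atTop (𝓝 0))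
    (hk : ∀ s, 0 < s → ‖u k s‖ ≤ M * Real.exp (-K * s)) (i : ℕ) {s : ℝ} (hs : 0 < s) :
    ‖u (k + i) s‖ ≤ M / K ^ i * Real.exp (-K * s) := by
  induction i generalizing s with
  | zero => simpa using hk s hs
  | succ i ih =>
    rw [pow_succ, ← div_div]
    exact norm_le_div_mul_exp_neg_of_hasDerivAt_neg hK (hu (k + i)) (hu0 _) (fun _ => ih) hs

theorem norm_le_sum_norm_mul_of_eq_sum_smul {K M : ℝ} {k : ℕ} {t : Finset ℕ} {c : ℕ → 𝕜}
    (hK : 1 ≤ K) (hu : ∀ j s, 0 < s → HasDerivAt (u (j + 1)) (-u j s) s)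
    (hu0 : ∀ j, Tendsto (u j) atTop (𝓝 0)) (ht : ∀ j ∈ t, k < j)
    (hsum : ∀ s, 0 < s → u k s = ∑ j ∈ t, c j • u j s)
    (hk : ∀ s, 0 < s → ‖u k s‖ ≤ M * Real.exp (-K * s)) {s : ℝ} (hs : 0 < s) :
    ‖u k s‖ ≤ (∑ j ∈ t, ‖c j‖) * (M / K) * Real.exp (-K * s) := by
  have hM : 0 ≤ M := nonneg_of_mul_nonneg_left ((norm_nonneg _).trans (hk s hs)) (Real.exp_pos _)
  have hterm (j : ℕ) (hj : j ∈ t) : ‖u j s‖ ≤ M / K * Real.exp (-K * s) := by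
    obtain ⟨i, rfl⟩ := Nat.exists_eq_add_of_lt (ht j hj)
    refine (norm_add_le_div_pow_mul_exp_neg (one_pos.trans_le hK) hu hu0 hk (i + 1) hs).trans ?_
    gcongr
    exact le_self_pow₀ hK i.succ_ne_zero
  rw [hsum s hs, mul_assoc, Finset.sum_mul]
  exact norm_sum_le_of_le t fun j hj => (norm_smul_le _ _).trans (by gcongr; exact hterm j hj)

/-- Each antiderivative gains a factor `1 / K` against the weight `exp (-K s)`, so for large `K`
a relation expressing `u k` through later members halves every bound on `u k`. -/
theorem eq_zero_of_eq_sum_smul {k : ℕ} {t : Finset ℕ} {c : ℕ → 𝕜}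
    (hu : ∀ j s, 0 < s → HasDerivAt (u (j + 1)) (-u j s) s)
    (hdecay : ∀ j K, ∃ C, ∀ s, 0 < s → ‖u j s‖ ≤ C * Real.exp (-K * s))
    (ht : ∀ j ∈ t, k < j) (hsum : ∀ s, 0 < s → u k s = ∑ j ∈ t, c j • u j s)
    {s : ℝ} (hs : 0 < s) : u k s = 0 := by
  have hu0 (j : ℕ) : Tendsto (u j) atTop (𝓝 0) := by
    obtain ⟨C, hC⟩ := hdecay j 1
    exact tendsto_zero_of_norm_le_exp_neg (C := C) (by simpa using hC)
  set A := ∑ j ∈ t, ‖c j‖ with hA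
  have hA0 : 0 ≤ A := Finset.sum_nonneg fun _ _ => norm_nonneg _
  have hAK : A / (2 * A + 1) ≤ 1 / 2 := by
    rw [div_le_div_iff₀ (by positivity) two_pos]
    linarith
  obtain ⟨C, hC⟩ := hdecay k (2 * A + 1)
  have hC0 : 0 ≤ C := nonneg_of_mul_nonneg_left ((norm_nonneg _).trans (hC s hs)) (Real.exp_pos _)
  have hiter (n : ℕ) :
      ∀ s, 0 < s → ‖u k s‖ ≤ C * (1 / 2) ^ n * Real.exp (-(2 * A + 1) * s) := by
    induction n with
    | zero => simpa using hC
    | succ n ih =>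
      intro s hs
      refine (norm_le_sum_norm_mul_of_eq_sum_smul (by linarith) hu hu0 ht hsum ih hs).trans ?_
      rw [← hA, mul_div_left_comm, pow_succ, ← mul_assoc C]
      gcongr
  have hlim : Tendsto (fun n : ℕ => C * (1 / 2) ^ n * Real.exp (-(2 * A + 1) * s)) atTop
      (𝓝 0) := by
    simpa using ((tendsto_pow_atTop_nhds_zero_of_lt_one (r := (1 / 2 : ℝ)) (by norm_num)
      (by norm_num)).const_mul C).mul_const (Real.exp (-(2 * A + 1) * s))
  exact norm_le_zero_iff.1 (ge_of_tendsto' hlim fun n => hiter n s hs)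

theorem eq_zero_of_hasDerivAt_neg {k : ℕ}
    (hu : ∀ j s, 0 < s → HasDerivAt (u (j + 1)) (-u j s) s)
    (hk : ∀ s, 0 < s → u k s = 0) : ∀ s, 0 < s → u 0 s = 0 := by
  induction k with
  | zero => exact hk
  | succ k ih =>
    refine ih fun s hs => ?_
    have hev : u (k + 1) =ᶠ[𝓝 s] fun _ => 0 := (eventually_gt_nhds hs).mono hk
    exact neg_eq_zero.1 ((hu k s hs).unique ((hasDerivAt_const s 0).congr_of_eventuallyEq hev))

theorem linearIndependent_of_hasDerivAt_neg
    (hu : ∀ j s, 0 < s → HasDerivAt (u (j + 1)) (-u j s) s)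
    (hdecay : ∀ j K, ∃ C, ∀ s, 0 < s → ‖u j s‖ ≤ C * Real.exp (-K * s))
    (hne : ∃ s, 0 < s ∧ u 0 s ≠ 0) :
    LinearIndependent 𝕜 fun j => (Set.Ioi (0 : ℝ)).domRestrict (u j) := by
  obtain ⟨s₀, hs₀, hne⟩ := hne
  rw [linearIndependent_iff']
  intro t g hg k
  have hg' (s : ℝ) (hs : 0 < s) : ∑ j ∈ t, g j • u j s = 0 := by
    simpa using congrFun hg ⟨s, hs⟩
  induction k using Nat.strong_induction_on with
  | _ k ih =>
    intro hk
    by_contra hgk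
    refine hne (eq_zero_of_hasDerivAt_neg (k := k) hu (fun s hs => ?_) s₀ hs₀)
    refine eq_zero_of_eq_sum_smul (t := t.filter (k < ·)) (c := fun j => -(g j / g k)) hu hdecay
      (by simp) (fun s hs => ?_) hs
    have hsplit : ∑ j ∈ t, g j • u j s = g k • u k s + ∑ j ∈ t with k < j, g j • u j s := by
      rw [← Finset.add_sum_erase t _ hk, Finset.sum_filter, ← Finset.sum_erase t (a := k) (by simp)]
      congr 1
      refine Finset.sum_congr rfl fun j hj => ?_
      obtain ⟨hjk, hjt⟩ := Finset.mem_erase.1 hj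
      rcases hjk.lt_or_gt with hlt | hgt
      · simp [ih j hlt hjt, hlt.not_gt]
      · simp [hgt]
    rw [hg' s hs] at hsplit
    simp only [div_eq_inv_mul, neg_smul, mul_smul, Finset.sum_neg_distrib, ← Finset.smul_sum]
    rw [← smul_neg, ← eq_neg_of_add_eq_zero_left hsplit.symm, inv_smul_smul₀ hgk]

end

theorem exists_exp_mul_sub_rpow_le {K κ : ℝ} (hK : 0 < K) (hκ : 1 < κ) (s : ℝ) :
    ∃ B, ∀ x, 0 ≤ x → Real.exp (s * x - K * x ^ κ) ≤ B := by
  obtain ⟨X, hX⟩ := eventually_atTop.1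
    ((tendsto_exp_mul_sub_rpow_atTop hK hκ s).eventually_le_const one_pos)
  refine ⟨max 1 (Real.exp (|s| * X)), fun x hx => ?_⟩
  rcases le_total X x with hXx | hxX
  · exact (hX x hXx).trans (le_max_left _ _)
  · refine le_max_of_le_right (Real.exp_le_exp.2 ?_)
    calc s * x - K * x ^ κ ≤ s * x := sub_le_self _ (by positivity)
      _ ≤ |s| * X := mul_le_mul (le_abs_self s) hxX hx (abs_nonneg s)

theorem exists_norm_saddleIntegral_zero_right_le_exp {σ ν : ℝ} (hσ : 1 < σ) (hν : ν ≤ 0) (K : ℝ) :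
    ∃ C, ∀ s, 0 < s → ‖saddleIntegral σ s 0 ν‖ ≤ C * Real.exp (-K * s) := by
  obtain ⟨D, hD⟩ := exists_norm_saddleIntegral_zero_right_le hσ le_rfl (ν := ν) (by simpa)
  simp only [neg_zero, Real.rpow_zero, mul_one] at hD
  have hc : 0 < 1 - 1 / σ := sub_pos.2 ((div_lt_one (one_pos.trans hσ)).2 hσ)
  have hκ : 1 < σ / (σ - 1) := (one_lt_div (sub_pos.2 hσ)).2 (by linarith)
  obtain ⟨B, hB⟩ := exists_exp_mul_sub_rpow_le hc hκ K
  have hD0 : 0 ≤ D :=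
    nonneg_of_mul_nonneg_left ((norm_nonneg _).trans (hD 0 le_rfl)) (Real.exp_pos _)
  refine ⟨D * B, fun s hs => (hD s hs.le).trans ?_⟩
  rw [mul_assoc]
  gcongr
  rw [neg_mul K, Real.exp_neg, ← div_eq_mul_inv, le_div_iff₀ (Real.exp_pos _), ← Real.exp_add,
    neg_mul, neg_add_eq_sub]
  exact hB s hs.le

theorem linearIndependent_saddleIntegral {σ : ℝ} (hσ : 1 < σ) :
    LinearIndependent ℂ fun j : ℕ =>
      (Set.Ioi (0 : ℝ)).domRestrict fun s => saddleIntegral σ s 0 (-j) := by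
  refine linearIndependent_of_hasDerivAt_neg (fun j s hs => ?_)
    (fun j => exists_norm_saddleIntegral_zero_right_le_exp hσ (by simp)) ?_
  · simpa using hasDerivAt_saddleIntegral hσ (-((j + 1 : ℕ) : ℝ)) hs
  · have hne : saddleIntegral σ 0 0 0 ≠ 0 := by
      rw [saddleIntegral_zero hσ]
      have : (σ : ℂ) ≠ 0 := by exact_mod_cast (one_pos.trans hσ).ne'
      have : (π : ℂ) ≠ 0 := by exact_mod_cast Real.pi_ne_zero
      simp [*]
    have hcont : ContinuousWithinAt (fun s => saddleIntegral σ s 0 0) (Set.Ioi 0) 0 :=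
      (continuousOn_saddleIntegral hσ 0 0 Set.self_mem_Ici).mono Set.Ioi_subset_Ici_self
    obtain ⟨s, hs, hs0⟩ := ((hcont.eventually_ne hne).and self_mem_nhdsWithin).exists
    exact ⟨s, hs0, by simpa using hs⟩

section

variable {n : ℕ}

theorem exists_polyAbs_le (Q : MvPolynomial (Fin n) ℂ) :
    ∃ (C : ℝ) (d : ℕ), 0 ≤ C ∧ ∀ y : EuclideanSpace ℝ (Fin n),
      polyAbs Q y ≤ C * (1 + ‖y‖) ^ d := by
  induction Q using MvPolynomial.induction_on with
  | C a => exact ⟨‖a‖, 0, norm_nonneg _, fun y => by simp [polyAbs]⟩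
  | add P Q hP hQ =>
    obtain ⟨C₁, d₁, h₁, hP⟩ := hP
    obtain ⟨C₂, d₂, h₂, hQ⟩ := hQ
    refine ⟨C₁ + C₂, d₁ + d₂, by positivity, fun y => ?_⟩
    have hy : 1 ≤ 1 + ‖y‖ := le_add_of_nonneg_right (norm_nonneg y)
    calc polyAbs (P + Q) y ≤ polyAbs P y + polyAbs Q y := by
          simpa [polyAbs] using norm_add_le _ _
      _ ≤ C₁ * (1 + ‖y‖) ^ (d₁ + d₂) + C₂ * (1 + ‖y‖) ^ (d₁ + d₂) := by
          refine add_le_add ((hP y).trans ?_) ((hQ y).trans ?_) <;> gcongr <;> omega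
      _ = _ := by ring
  | mul_X P i hP =>
    obtain ⟨C, d, h, hP⟩ := hP
    refine ⟨C, d + 1, h, fun y => ?_⟩
    have hyi : |y i| ≤ ‖y‖ := by simpa using PiLp.norm_apply_le y i
    calc polyAbs (P * MvPolynomial.X i) y = polyAbs P y * |y i| := by simp [polyAbs]
      _ ≤ C * (1 + ‖y‖) ^ d * (1 + ‖y‖) := by
          gcongr
          · exact hP y
          · linarith
      _ = _ := by ring

theorem memLp_one_add_norm_rpow_neg {N : ℝ} {p : ℝ≥0∞} (hp : 1 ≤ p) (hN : n < N) :
    MemLp (fun x : EuclideanSpace ℝ (Fin n) => (1 + ‖x‖) ^ (-N)) p := by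
  have hmeas : AEStronglyMeasurable fun x : EuclideanSpace ℝ (Fin n) => (1 + ‖x‖) ^ (-N) :=
    (by fun_prop : Measurable _).aestronglyMeasurable
  have hint : Integrable fun x : EuclideanSpace ℝ (Fin n) => (1 + ‖x‖) ^ (-N) :=
    integrable_one_add_norm (by simpa using hN)
  have hle (x : EuclideanSpace ℝ (Fin n)) : (1 + ‖x‖) ^ (-N) ≤ 1 :=
    Real.rpow_le_one_of_one_le_of_nonpos (le_add_of_nonneg_right (norm_nonneg x))
      (neg_nonpos.2 (n.cast_nonneg.trans hN.le))
  rcases eq_or_ne p ∞ with rfl | hpt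
  · refine memLp_top_of_bound hmeas 1 (Eventually.of_forall fun x => ?_)
    rw [Real.norm_of_nonneg (by positivity)]
    exact hle x
  · have hp1 : 1 ≤ p.toReal := by simpa using ENNReal.toReal_mono hpt hp
    rw [← integrable_norm_rpow_iff hmeas (one_pos.trans_le hp).ne' hpt]
    refine hint.mono' (by fun_prop : Measurable _).aestronglyMeasurable
      (Eventually.of_forall fun x => ?_)
    rw [Real.norm_of_nonneg (by positivity), Real.norm_of_nonneg (by positivity)]
    exact Real.rpow_le_self_of_le_one (by positivity) (hle x) hp1

theorem spaceDecay_of_le_one_add_norm_rpow_neg {a α D N : ℝ} {p : ℝ≥0∞} (hp : 1 ≤ p)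
    {f : EuclideanSpace ℝ (Fin n) → ℂ} (hf : AEStronglyMeasurable f) (hN : n < N)
    (hb : ∀ x, Real.exp (a * ‖x‖ ^ α) * ‖f x‖ ≤ D * (1 + ‖x‖) ^ (-N)) :
    SpaceDecay a α p f := by
  refine (memLp_one_add_norm_rpow_neg hp hN).of_le_mul (c := D) ?_
    (Eventually.of_forall fun x => ?_)
  · refine AEStronglyMeasurable.mul (Measurable.aestronglyMeasurable ?_) hf
    fun_prop
  · rw [norm_mul, Complex.norm_real, Real.norm_of_nonneg (Real.exp_nonneg _),
      Real.norm_of_nonneg (by positivity)]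
    exact hb x

theorem rpow_mul_rpow_le_mul_rpow_neg {w X Y C D N δ r : ℝ} {d : ℕ} (hw : 1 ≤ w) (hr : 1 ≤ r)
    (hδ : 0 ≤ δ) (hN : 0 ≤ N) (hC : 0 ≤ C) (hX0 : 0 ≤ X) (hY0 : 0 ≤ Y) (hX : X ≤ D * w ^ (-N))
    (hY : Y ≤ C * w ^ d) : X ^ r * Y ^ δ ≤ D ^ r * C ^ δ * w ^ (-(N - d * δ)) := by
  have hw0 : 0 < w := one_pos.trans_le hw
  have hD : 0 ≤ D := nonneg_of_mul_nonneg_left (hX0.trans hX) (by positivity)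
  have hXr : X ^ r ≤ D ^ r * w ^ (-N) := by
    calc X ^ r ≤ (D * w ^ (-N)) ^ r := by gcongr
      _ = D ^ r * (w ^ (-N)) ^ r := Real.mul_rpow hD (by positivity)
      _ ≤ _ := by
        gcongr
        exact Real.rpow_le_self_of_le_one (by positivity)
          (Real.rpow_le_one_of_one_le_of_nonpos hw (neg_nonpos.2 hN)) hr
  have hYδ : Y ^ δ ≤ C ^ δ * w ^ (d * δ) := by
    calc Y ^ δ ≤ (C * w ^ d) ^ δ := by gcongr
      _ = _ := by
        rw [Real.mul_rpow hC (by positivity), ← Real.rpow_natCast, ← Real.rpow_mul hw0.le]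
  calc X ^ r * Y ^ δ ≤ D ^ r * w ^ (-N) * (C ^ δ * w ^ (d * δ)) := by gcongr
    _ = _ := by rw [mul_mul_mul_comm, ← Real.rpow_add hw0, neg_sub', sub_neg_eq_add]

theorem fourierDecay_of_le_one_add_norm_rpow_neg {d : ℕ} {b β δ C D N : ℝ} {q : ℝ≥0∞} (hq : 1 ≤ q)
    (hδ : 0 ≤ δ) {Q : MvPolynomial (Fin n) ℂ} (hC : 0 ≤ C)
    (hQ : ∀ y, polyAbs Q y ≤ C * (1 + ‖y‖) ^ d) {f : EuclideanSpace ℝ (Fin n) → ℂ}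
    (hN : n + d * δ < N)
    (hb : ∀ y, Real.exp (b * ‖y‖ ^ β) * ‖fourierHat f y‖ ≤ D * (1 + ‖y‖) ^ (-N)) :
    FourierDecay b β δ q Q f := by
  have hdδ : 0 ≤ d * δ := by positivity
  have : (0 : ℝ) ≤ n := n.cast_nonneg
  have hw (y : EuclideanSpace ℝ (Fin n)) : 1 ≤ 1 + ‖y‖ :=
    le_add_of_nonneg_right (norm_nonneg y)
  have hle {r : ℝ} (hr : 1 ≤ r) (y : EuclideanSpace ℝ (Fin n)) :=
    rpow_mul_rpow_le_mul_rpow_neg (hw y) hr hδ (by linarith) hC (by positivity)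
      (polyAbs_nonneg Q y) (hb y) (hQ y)
  refine ⟨fun hqt => ?_, fun _ => ⟨D ^ (1 : ℝ) * C ^ δ, Eventually.of_forall fun y => ?_⟩⟩
  · have hq1 : 1 ≤ q.toReal := by simpa using ENNReal.toReal_mono hqt hq
    have hint : Integrable fun y : EuclideanSpace ℝ (Fin n) => (1 + ‖y‖) ^ (-(N - d * δ)) :=
      integrable_one_add_norm (by rw [finrank_euclideanSpace_fin]; linarith)
    refine lt_of_le_of_lt (lintegral_mono fun y => ENNReal.ofReal_le_ofReal ?_)
      (hint.const_mul (D ^ q.toReal * C ^ δ)).lintegral_lt_top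
    refine le_of_eq_of_le ?_ (hle hq1 y)
    rw [Real.mul_rpow (by positivity) (by positivity), ← Real.exp_mul]
    ring_nf
  · have hD : 0 ≤ D :=
      nonneg_of_mul_nonneg_left ((by positivity : (0 : ℝ) ≤ _).trans (hb y)) (by positivity)
    refine le_trans (by simpa using hle le_rfl y) (mul_le_of_le_one_right (by positivity) ?_)
    exact Real.rpow_le_one_of_one_le_of_nonpos (hw y) (by linarith)

end

section

variable {n : ℕ} {σ ℓ N ν : ℝ}

theorem exists_one_add_mul_sq_rpow_neg_le (hℓ : 0 < ℓ) (hN : 0 ≤ N) :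
    ∃ K, ∀ r, 0 ≤ r → (1 + ℓ * r ^ 2) ^ (-N) ≤ K * (1 + r) ^ (-N) := by
  have hK : 0 < 2 + 1 / ℓ := by positivity
  refine ⟨(2 + 1 / ℓ) ^ N, fun r hr => ?_⟩
  have hle : (1 + r) / (2 + 1 / ℓ) ≤ 1 + ℓ * r ^ 2 := by
    rw [div_le_iff₀' hK]
    calc 1 + r ≤ 2 + r ^ 2 := by nlinarith [sq_nonneg (r - 1)]
      _ ≤ 2 + r ^ 2 + (1 / ℓ + 2 * ℓ * r ^ 2) := le_add_of_nonneg_right (by positivity)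
      _ = (2 + 1 / ℓ) * (1 + ℓ * r ^ 2) := by field_simp; ring
  calc (1 + ℓ * r ^ 2) ^ (-N) ≤ ((1 + r) / (2 + 1 / ℓ)) ^ (-N) :=
        Real.rpow_le_rpow_of_nonpos (by positivity) hle (neg_nonpos.2 hN)
    _ = _ := by
        rw [Real.div_rpow (by linarith) hK.le, Real.rpow_neg hK.le, div_inv_eq_mul, mul_comm]

theorem exists_exp_mul_norm_comp_mul_sq_le {E : Type*} [SeminormedAddCommGroup E] {G : ℝ → E}
    {c κ D : ℝ} (hℓ : 0 < ℓ) (hN : 0 ≤ N)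
    (hG : ∀ s, 0 ≤ s → ‖G s‖ ≤ D * (1 + s) ^ (-N) * Real.exp (-c * s ^ κ)) :
    ∃ D', ∀ r, 0 ≤ r →
      Real.exp (c * (ℓ * r ^ 2) ^ κ) * ‖G (ℓ * r ^ 2)‖ ≤ D' * (1 + r) ^ (-N) := by
  obtain ⟨K, hK⟩ := exists_one_add_mul_sq_rpow_neg_le hℓ hN
  have hD : 0 ≤ D := by
    have hG0 := (norm_nonneg _).trans (hG 0 le_rfl)
    rw [mul_assoc] at hG0
    exact nonneg_of_mul_nonneg_left hG0 (by positivity)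
  refine ⟨D * K, fun r hr => ?_⟩
  calc _ ≤ Real.exp (c * (ℓ * r ^ 2) ^ κ) *
        (D * (1 + ℓ * r ^ 2) ^ (-N) * Real.exp (-c * (ℓ * r ^ 2) ^ κ)) := by
        gcongr
        exact hG _ (by positivity)
    _ = D * (1 + ℓ * r ^ 2) ^ (-N) := by
        rw [mul_left_comm, ← Real.exp_add, neg_mul, add_neg_cancel, Real.exp_zero, mul_one]
    _ ≤ D * (K * (1 + r) ^ (-N)) := by
        gcongr
        exact hK r hr
    _ = _ := (mul_assoc _ _ _).symm

/-- The radial superposition of complex Gaussians `exp (-ℓ |x|² e^w)` along the Hankel contour. -/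
noncomputable def radialSaddle (σ ℓ ν : ℝ) (x : EuclideanSpace ℝ (Fin n)) : ℂ :=
  saddleIntegral σ (ℓ * ‖x‖ ^ 2) 0 ν

theorem continuous_radialSaddle (hσ : 1 < σ) (hℓ : 0 ≤ ℓ) (ν : ℝ) :
    Continuous (radialSaddle (n := n) σ ℓ ν) :=
  (continuousOn_saddleIntegral hσ ν).comp_continuous (by fun_prop)
    fun x => Set.mem_Ici.2 (by positivity)

theorem exists_norm_radialSaddle_le (hσ : 1 < σ) (hℓ : 0 < ℓ) (hN : 0 ≤ N)
    (hν : ν ≤ -N * (σ - 1)) : ∃ D, ∀ x : EuclideanSpace ℝ (Fin n),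
      Real.exp ((1 - 1 / σ) * (ℓ * ‖x‖ ^ 2) ^ (σ / (σ - 1))) * ‖radialSaddle σ ℓ ν x‖ ≤
        D * (1 + ‖x‖) ^ (-N) := by
  obtain ⟨D, hD⟩ := exists_norm_saddleIntegral_zero_right_le hσ hN hν
  obtain ⟨D', hD'⟩ := exists_exp_mul_norm_comp_mul_sq_le hℓ hN hD
  exact ⟨D', fun x => hD' ‖x‖ (norm_nonneg x)⟩

theorem exists_norm_fourierHat_radialSaddle_le (hσ : 1 < σ) (hℓ : 0 < ℓ) (hN : 0 ≤ N)
    (hν : ν ≤ -N * (σ + 1)) : ∃ D, ∀ y : EuclideanSpace ℝ (Fin n),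
      Real.exp (Real.cos (sectorAngle σ) * (1 + 1 / σ) *
          ((4 * ℓ)⁻¹ * ‖y‖ ^ 2) ^ (σ / (σ + 1))) * ‖fourierHat (radialSaddle σ ℓ ν) y‖ ≤
        D * (1 + ‖y‖) ^ (-N) := by
  obtain ⟨D, hD⟩ := exists_norm_saddleIntegral_zero_left_le hσ hN
    ((sub_le_self ν (by positivity : (0 : ℝ) ≤ n / 2)).trans hν)
  obtain ⟨D', hD'⟩ :=
    exists_exp_mul_norm_comp_mul_sq_le (by positivity : 0 < (4 * ℓ)⁻¹) hN hD
  refine ⟨(π / ℓ) ^ ((n : ℝ) / 2) * D', fun y => ?_⟩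
  have hF : ‖fourierHat (radialSaddle σ ℓ ν) y‖ = (π / ℓ) ^ ((n : ℝ) / 2) *
      ‖saddleIntegral σ 0 ((4 * ℓ)⁻¹ * ‖y‖ ^ 2) (ν - (n : ℝ) / 2)‖ := by
    rw [inv_mul_eq_div, ← Real.norm_of_nonneg (by positivity : 0 ≤ (π / ℓ) ^ ((n : ℝ) / 2)),
      ← Complex.norm_real, ← norm_mul]
    exact congrArg norm (fourierHat_saddleIntegral hσ hℓ ν y)
  rw [hF, mul_left_comm, mul_assoc (_ ^ _)]
  exact mul_le_mul_of_nonneg_left (hD' ‖y‖ (norm_nonneg y)) (by positivity)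

theorem linearIndependent_radialSaddle [NeZero n] (hσ : 1 < σ) (hℓ : 0 < ℓ) :
    LinearIndependent ℂ fun j : ℕ => (AEEqFun.mk (radialSaddle (n := n) σ ℓ (-j))
      (continuous_radialSaddle hσ hℓ.le _).aestronglyMeasurable :
        EuclideanSpace ℝ (Fin n) →ₘ[volume] ℂ) := by
  let F (j : ℕ) : C(EuclideanSpace ℝ (Fin n), ℂ) :=
    ⟨radialSaddle σ ℓ (-j), continuous_radialSaddle hσ hℓ.le _⟩
  let ρ (s : Set.Ioi (0 : ℝ)) : EuclideanSpace ℝ (Fin n) := EuclideanSpace.single 0 (√(s / ℓ))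
  have hρ (s : Set.Ioi (0 : ℝ)) : ℓ * ‖ρ s‖ ^ 2 = s := by
    have : 0 < (s : ℝ) := s.2
    rw [PiLp.norm_single, Real.norm_of_nonneg (Real.sqrt_nonneg _), Real.sq_sqrt (by positivity)]
    field_simp
  have hF : LinearIndependent ℂ F := by
    refine .of_comp (LinearMap.funLeft ℂ ℂ ρ ∘ₗ ContinuousMap.coeFnLinearMap ℂ) ?_
    convert linearIndependent_saddleIntegral hσ using 1
    ext j s
    exact congrArg (saddleIntegral σ · 0 (-j)) (hρ s)
  have hinj : Function.Injective (ContinuousMap.toAEEqFunLinearMap (𝕜 := ℂ) (γ := ℂ)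
      (volume : Measure (EuclideanSpace ℝ (Fin n)))) := fun f g hfg =>
    ContinuousMap.ext (congrFun ((f.continuous.ae_eq_iff_eq volume g.continuous).1
      (AEEqFun.mk_eq_mk.1 hfg)))
  exact hF.map' _ (LinearMap.ker_eq_bot.2 hinj)

end

/-- The order `σ` for which `radialSaddle σ` decays like `exp (-|x|^α)` up to a scaling. -/
noncomputable def saddleOrder (α : ℝ) : ℝ := α / (α - 2)

/-- The scale `ℓ` which gives `radialSaddle (saddleOrder α) ℓ` the rate `a` of decay. -/
noncomputable def saddleScale (a α : ℝ) : ℝ := (a * α / 2) ^ (2 / α)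

section

variable {a b α β : ℝ}

theorem one_lt_saddleOrder (hα : 2 < α) : 1 < saddleOrder α :=
  (one_lt_div (sub_pos.2 hα)).2 (by linarith)

theorem saddleOrder_add_one (hα : 2 < α) : saddleOrder α + 1 = 2 * (α - 1) / (α - 2) := by
  have : α - 2 ≠ 0 := by linarith
  unfold saddleOrder
  field_simp
  ring

theorem sq_rpow_div_two {r : ℝ} (hr : 0 ≤ r) (κ : ℝ) : (r ^ 2) ^ (κ / 2) = r ^ κ := by
  rw [← Real.rpow_natCast_mul hr, Nat.cast_ofNat, mul_div_cancel₀ _ two_ne_zero]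

theorem saddleScale_pos (ha : 0 < a) (hα : 0 < α) : 0 < saddleScale a α := by
  unfold saddleScale
  positivity

theorem one_sub_one_div_saddleOrder_mul_rpow (ha : 0 < a) (hα : 2 < α) {r : ℝ} (hr : 0 ≤ r) :
    (1 - 1 / saddleOrder α) *
      (saddleScale a α * r ^ 2) ^ (saddleOrder α / (saddleOrder α - 1)) = a * r ^ α := by
  have hα0 : 0 < α := by linarith
  have : α - 2 ≠ 0 := by linarith
  have hexp : saddleOrder α / (saddleOrder α - 1) = α / 2 := by
    unfold saddleOrder
    field_simp
    ring
  have hcoef : 1 - 1 / saddleOrder α = 2 / α := by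
    unfold saddleOrder
    field_simp
    ring
  have hscale : saddleScale a α ^ (α / 2) = a * α / 2 := by
    rw [saddleScale, ← inv_div α 2, Real.rpow_inv_rpow (by positivity) (by positivity)]
  rw [hexp, hcoef, Real.mul_rpow (saddleScale_pos ha hα0).le (by positivity), hscale,
    sq_rpow_div_two hr]
  field_simp

theorem cos_sectorAngle_saddleOrder (hαβ : α.HolderConjugate β) (hα : 2 < α) :
    Real.cos (sectorAngle (saddleOrder α)) = Real.sin (π / 2 * (β - 1)) := by
  have hα1 : α - 1 ≠ 0 := by linarith
  have : α - 2 ≠ 0 := by linarith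
  rw [← Real.cos_pi_div_two_sub, sectorAngle, saddleOrder_add_one hα, hαβ.conjugate_eq]
  congr 1
  field_simp
  ring

theorem four_mul_saddleScale_rpow (hαβ : α.HolderConjugate β) (ha : 0 < a) :
    (4 * saddleScale a α) ^ (β / 2) = 2 * (a * α) ^ (β - 1) := by
  have hα : 0 < α := hαβ.pos
  have hfour : (4 : ℝ) ^ (β / 2) = 2 ^ β := by
    rw [show (4 : ℝ) = 2 ^ (2 : ℝ) by norm_num, ← Real.rpow_mul two_pos.le,
      mul_div_cancel₀ _ two_ne_zero]
  have hscale : saddleScale a α ^ (β / 2) = (a * α) ^ (β - 1) / 2 ^ (β - 1) := by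
    rw [saddleScale, ← Real.rpow_mul (by positivity), ← Real.div_rpow (by positivity) two_pos.le]
    congr 1
    have hα1 := hαβ.sub_one_ne_zero
    rw [hαβ.conjugate_eq]
    field_simp
    ring
  rw [Real.mul_rpow (by positivity) (saddleScale_pos ha hα).le, hfour, hscale,
    Real.rpow_sub_one two_ne_zero]
  field_simp

theorem cos_sectorAngle_saddleOrder_mul_rpow (hαβ : α.HolderConjugate β) (ha : 0 < a) (hα : 2 < α)
    (hab : (a * α) ^ (β - 1) * (b * β) = Real.sin (π / 2 * (β - 1))) {r : ℝ} (hr : 0 ≤ r) :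
    Real.cos (sectorAngle (saddleOrder α)) * (1 + 1 / saddleOrder α) *
      ((4 * saddleScale a α)⁻¹ * r ^ 2) ^ (saddleOrder α / (saddleOrder α + 1)) = b * r ^ β := by
  have hα0 : 0 < α := hαβ.pos
  have hβ0 : 0 < β := hαβ.symm.pos
  have hα1 := hαβ.sub_one_ne_zero
  have hα2 : α - 2 ≠ 0 := by linarith
  have hexp : saddleOrder α / (saddleOrder α + 1) = β / 2 := by
    rw [saddleOrder_add_one hα, saddleOrder, hαβ.conjugate_eq]
    field_simp
  have hcoef : 1 + 1 / saddleOrder α = 2 / β := by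
    rw [saddleOrder, hαβ.conjugate_eq]
    field_simp
    ring
  have hℓ := saddleScale_pos ha hα0
  have : 0 < (a * α) ^ (β - 1) := by positivity
  rw [hexp, hcoef, cos_sectorAngle_saddleOrder hαβ hα, Real.mul_rpow (by positivity)
    (by positivity), Real.inv_rpow (by positivity), four_mul_saddleScale_rpow hαβ ha,
    sq_rpow_div_two hr, ← hab]
  field_simp

variable {n : ℕ} {N ν : ℝ}

theorem spaceDecay_radialSaddle {p : ℝ≥0∞} (ha : 0 < a) (hα : 2 < α) (hp : 1 ≤ p) (hN : n < N)
    (hν : ν ≤ -N * (saddleOrder α - 1)) :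
    SpaceDecay (n := n) a α p (radialSaddle (saddleOrder α) (saddleScale a α) ν) := by
  have hσ := one_lt_saddleOrder hα
  have hℓ := saddleScale_pos ha (two_pos.trans hα)
  obtain ⟨D, hD⟩ := exists_norm_radialSaddle_le (n := n) hσ hℓ (n.cast_nonneg.trans hN.le) hν
  refine spaceDecay_of_le_one_add_norm_rpow_neg hp
    (continuous_radialSaddle hσ hℓ.le ν).aestronglyMeasurable hN (D := D) fun x => ?_
  simpa only [one_sub_one_div_saddleOrder_mul_rpow ha hα (norm_nonneg x)] using hD x

theorem fourierDecay_radialSaddle {d : ℕ} {C δ : ℝ} {q : ℝ≥0∞} {Q : MvPolynomial (Fin n) ℂ}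
    (hαβ : α.HolderConjugate β) (ha : 0 < a) (hα : 2 < α)
    (hab : (a * α) ^ (β - 1) * (b * β) = Real.sin (π / 2 * (β - 1))) (hq : 1 ≤ q) (hδ : 0 ≤ δ)
    (hC : 0 ≤ C) (hQ : ∀ y, polyAbs Q y ≤ C * (1 + ‖y‖) ^ d) (hN : n + d * δ < N)
    (hν : ν ≤ -N * (saddleOrder α + 1)) :
    FourierDecay b β δ q Q (radialSaddle (saddleOrder α) (saddleScale a α) ν) := by
  have hN0 : 0 ≤ N := (by positivity : 0 ≤ n + d * δ).trans hN.le
  obtain ⟨D, hD⟩ := exists_norm_fourierHat_radialSaddle_le (one_lt_saddleOrder hα)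
    (saddleScale_pos ha (two_pos.trans hα)) hN0 hν
  refine fourierDecay_of_le_one_add_norm_rpow_neg hq hδ hC hQ hN (D := D) fun y => ?_
  simpa only [cos_sectorAngle_saddleOrder_mul_rpow hαβ ha hα hab (norm_nonneg y)] using hD y

theorem exists_linearIndependent_decay [NeZero n] {δ : ℝ} {p q : ℝ≥0∞} (ha : 0 < a) (hα : 2 < α)
    (hαβ : α.HolderConjugate β) (hδ : 0 ≤ δ) (hp : 1 ≤ p) (hq : 1 ≤ q)
    (Q : MvPolynomial (Fin n) ℂ)
    (hab : (a * α) ^ (β - 1) * (b * β) = Real.sin (π / 2 * (β - 1))) :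
    ∃ (f : ℕ → EuclideanSpace ℝ (Fin n) → ℂ) (hf : ∀ j, AEStronglyMeasurable (f j) volume),
      LinearIndependent ℂ (fun j => AEEqFun.mk (f j) (hf j)) ∧
      ∀ j, SpaceDecay a α p (f j) ∧ FourierDecay b β δ q Q (f j) := by
  obtain ⟨C, d, hC, hQ⟩ := exists_polyAbs_le Q
  have hσ := one_lt_saddleOrder hα
  have hℓ := saddleScale_pos ha (two_pos.trans hα)
  obtain ⟨N, hN⟩ := exists_gt (n + d * δ)
  have hdδ : 0 ≤ d * δ := by positivity
  have : 0 ≤ N := (by positivity : 0 ≤ n + d * δ).trans hN.le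
  obtain ⟨k, hk⟩ := exists_nat_ge (N * (saddleOrder α + 1))
  have hν (j : ℕ) : -((k + j : ℕ) : ℝ) ≤ -N * (saddleOrder α + 1) := by
    push_cast
    linarith [j.cast_nonneg (α := ℝ)]
  refine ⟨fun j => radialSaddle (saddleOrder α) (saddleScale a α) (-(k + j : ℕ)),
    fun j => (continuous_radialSaddle hσ hℓ.le _).aestronglyMeasurable,
    (linearIndependent_radialSaddle hσ hℓ).comp (k + ·) (add_right_injective k), fun j => ⟨?_, ?_⟩⟩
  · exact spaceDecay_radialSaddle ha hα hp (lt_of_le_of_lt (le_add_of_nonneg_right hdδ) hN)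
      ((hν j).trans (by linarith))
  · exact fourierDecay_radialSaddle hαβ ha hα hab hq hδ hC hQ hN (hν j)

end

theorem theorem2p4 (n : ℕ) (hn : 1 ≤ n) (a b α β δ : ℝ) (ha : 0 < a) (hb : 0 < b)
    (hα : 2 < α) (hαβ : 1 / α + 1 / β = 1) (hδ : 0 < δ)
    (p q : ℝ≥0∞) (hp : 1 ≤ p) (hq : 1 ≤ q)
    (Q : MvPolynomial (Fin n) ℂ) (hQ : Q ≠ 0) :
    ((a * α) ^ (1 / α) * (b * β) ^ (1 / β) > Real.sin (Real.pi / 2 * (β - 1)) ^ (1 / β) →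
      ∀ f : EuclideanSpace ℝ (Fin n) → ℂ, AEStronglyMeasurable f volume →
        SpaceDecay a α p f → FourierDecay b β δ q Q f → f =ᵐ[volume] 0) ∧
    ((a * α) ^ (1 / α) * (b * β) ^ (1 / β) = Real.sin (Real.pi / 2 * (β - 1)) ^ (1 / β) →
      ∃ (f : ℕ → EuclideanSpace ℝ (Fin n) → ℂ)
        (hf : ∀ j, AEStronglyMeasurable (f j) volume),
        LinearIndependent ℂ (fun j => AEEqFun.mk (f j) (hf j)) ∧
        ∀ j, SpaceDecay a α p (f j) ∧ FourierDecay b β δ q Q (f j)) := by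
  obtain ⟨m, rfl⟩ : ∃ m, n = m + 1 := ⟨n - 1, by omega⟩
  have hconj : α.HolderConjugate β := Real.holderConjugate_iff.2 ⟨by linarith, by simpa using hαβ⟩
  have : 0 < α := hconj.pos
  have hα1 : 0 < α - 1 := hconj.sub_one_pos
  have hβ1 : 1 < β := hconj.symm.lt
  have hβ0 : 0 < β := hconj.symm.pos
  have hβ2 : β < 2 := by rw [hconj.conjugate_eq, div_lt_iff₀ hα1]; linarith
  have hS := sin_pi_div_two_mul_sub_one_pos hβ1 hβ2
  have hpow : ((a * α) ^ (1 / α) * (b * β) ^ (1 / β)) ^ β = (a * α) ^ (β - 1) * (b * β) :=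
    rpow_inv_mul_rpow_inv_rpow hconj (by positivity) (by positivity)
  have hSpow : (Real.sin (π / 2 * (β - 1)) ^ (1 / β)) ^ β = Real.sin (π / 2 * (β - 1)) := by
    rw [one_div, Real.rpow_inv_rpow hS.le hβ0.ne']
  refine ⟨fun h f hfm hf hff => ?_, fun h => ?_⟩
  · have hab : Real.sin (π / 2 * (β - 1)) < (a * α) ^ (β - 1) * (b * β) := by
      simpa only [hpow, hSpow] using Real.rpow_lt_rpow (by positivity) h hβ0
    exact ae_eq_zero_of_spaceDecay_of_fourierDecay hconj hβ2 ha hb hδ.le hp hq hQ hab hfm hf hff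
  · exact exists_linearIndependent_decay ha hα hconj hδ.le hp hq Q (by rw [← hSpow, ← h, hpow])
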